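/- Let $d\ge 1$. Let $(\mathcal R,\eta_{\mathcal R})$ and $(\mathcal B,\eta_{\mathcal B})$ be two marked point processes on $\mathbb R^d$ (red and blue), defined on a common probability space and jointly translation-invariant and ergodic under translations. Their ground processes $\mathcal R$ and $\mathcal B$ are simple and locally finite, with finite intensities $\lambda_{\mathcal R}$ and $\lambda_{\mathcal B}$ (expected number of points in a Euclidean ball of unit volume). Conditionally on $\mathcal R$, the marks $X_x$ of the red points $x\in[\mathcal R]$ are i.i.d. with the law of a random variable $X$, and conditionally on $\mathcal B$, the marks $Y_y$ of the blue points $y\in[\mathcal B]$ are i.i.d. with the law of a random variable $Y$, where $X$ and $Y$ take values in $\{1,2,\dots\}$ and $\mathbb E(X),\mathbb E(Y)<\infty$; here $[\cdot]$ denotes the set of points. The mark of a point is its number of stubs. Suppose that almost surely $S=[\mathcal R]\cup[\mathcal B]$ is non-equidistant (there are no distinct $x,y,z\in S$ with $|x-y|=|x-z|$ and no distinct $x,y,u,w\in S$ with $|x-y|=|u-w|$) and has no descending chain (no infinite sequence $x_0,x_1,\dots$ in $S$ with $|x_i-x_{i-1}|$ strictly decreasing). A two-color multi-matching is a simple bipartite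 graph between the red and the blue points in which every red point $x$ has degree $X_x$ and every blue point $y$ has degree $Y_y$; in a partial multi-matching the degrees are at most $X_x$ and $Y_y$. A random such graph is called a scheme if its edge set is a point process on the space of pairs of points whose law is invariant under all translations. A multi-matching is stable if for any red $x$ and blue $y$, either $x,y$ are linked by an edge, or at least one of them has no incident edge longer than $|x-y|$. For a partial multi-matching, stability means the same with an unmatched stub counted as an incident edge of infinite length. The algorithm 2CIMC starts from the graph without edges. Given the edges created so far, call a red point and a blue point compatible if each of them has fewer edges than stubs and there is no edge between them. In each step, simultaneously create an edge between all compatible $x,y$ such that $y$ is the closest point among those compatible with $x$, and $x$ is the closest point among those compatible with $y$. The output is the union of the edge sets over all steps. (a) If $\lambda_{\mathcal R}\mathbb E(X)=\lambda_{\mathcal B}\mathbb E(Y)$, then almost surely 2CIMC uses up all stubs, its output is a two-color stable multi-matching scheme, and almost surely no other two-color stable multi-matching of the given marked points exists. (b) If $\lambda_{\mathcal R}\mathbb E(X)\neq\lambda_{\mathcal B}\mathbb E(Y)$, then the output of 2CIMC is a translation-invariant two-color partial stable multi-matching scheme which almost surely uses up all stubs of the color with the smaller stub intensity, that is, all red stubs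 if $\lambda_{\mathcal R}\mathbb E(X)<\lambda_{\mathcal B}\mathbb E(Y)$ and all blue stubs if $\lambda_{\mathcal R}\mathbb E(X)>\lambda_{\mathcal B}\mathbb E(Y)$. -/

import Mathlib

open MeasureTheory Set
open scoped ENNReal

noncomputable section

namespace TwoColor

/-- Euclidean space `ℝ^d`. -/
abbrev Space (d : ℕ) : Type := EuclideanSpace ℝ (Fin d)

/-- A realization of a marked point process on `ℝ^d` with simple ground process and marks in
`{1, 2, …}`: the points are the `x` with `stubs x ≠ 0`, they form a locally finite set, and the
mark (number of stubs) of the point `x` is `stubs x`. -/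
@[ext] structure MarkedConfig (d : ℕ) where
  stubs : Space d → ℕ
  locallyFinite : ∀ s : Set (Space d), Bornology.IsBounded s →
    (Function.support stubs ∩ s).Finite

namespace MarkedConfig

variable {d : ℕ}

/-- The point set (support) of the ground process. -/
def points (c : MarkedConfig d) : Set (Space d) := Function.support c.stubs

/-- The counting measure `∑ δ_(x, mark of x)` on `ℝ^d × ℕ`. -/
def toMeasure (c : MarkedConfig d) : Measure (Space d × ℕ) :=
  Measure.count.restrict {p | p.1 ∈ c.points ∧ p.2 = c.stubs p.1}

/-- The usual σ-algebra on marked configurations, generated by the numbers of points in Borel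
subsets of `ℝ^d × ℕ`. -/
instance : MeasurableSpace (MarkedConfig d) :=
  MeasurableSpace.comap toMeasure inferInstance

/-- The configuration with the same points as `c` and with the marks replaced by `f`. -/
def remark (c : MarkedConfig d) (f : c.points → ℕ) : MarkedConfig d where
  stubs x := by
    classical
    exact if h : x ∈ c.points then f ⟨x, h⟩ else 0
  locallyFinite s hs := by
    refine (c.locallyFinite s hs).subset (inter_subset_inter_left s ?_)
    intro x hx
    by_contra h
    exact hx (dif_neg h)

/-- Translation of a marked configuration by `v`: the point `x` is moved to `v + x` and keeps
its mark. -/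
instance : AddAction (Space d) (MarkedConfig d) where
  vadd v c :=
    { stubs := fun x => c.stubs (x - v)
      locallyFinite := fun s hs => by
        have hb : Bornology.IsBounded ((fun x : Space d => x - v) '' s) := by
          have h : LipschitzWith 1 (fun x : Space d => x - v) :=
            LipschitzWith.of_dist_le_mul (by simp)
          exact h.isBounded_image hs
        refine Set.Finite.of_finite_image (f := fun x : Space d => x - v) ?_
          (fun a _ b _ h => by simpa using h)
        refine (c.locallyFinite _ hb).subset ?_
        rintro _ ⟨x, ⟨hx, hxs⟩, rfl⟩
        exact ⟨hx, x, hxs, rfl⟩ }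
  zero_vadd c := by
    ext x
    change c.stubs (x - 0) = c.stubs x
    rw [sub_zero]
  add_vadd v w c := by
    ext x
    change c.stubs (x - (v + w)) = c.stubs (x - v - w)
    rw [sub_sub]

end MarkedConfig

section Processes

variable {d : ℕ} {Ω : Type*} [MeasurableSpace Ω]

/-- The radius of the Euclidean balls of unit volume in `ℝ^d` (`d ≥ 1`). -/
def unitVolumeRadius (d : ℕ) : ℝ :=
  (volume (Metric.ball (0 : Space d) 1)).toReal ^ (-(1 / (d : ℝ)))

theorem volume_ball_unitVolumeRadius (hd : 1 ≤ d) :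
    volume (Metric.ball (0 : Space d) (unitVolumeRadius d)) = 1 := by
  have hfin : volume (Metric.ball (0 : Space d) 1) ≠ ∞ := measure_ball_lt_top.ne
  have hpos : 0 < (volume (Metric.ball (0 : Space d) 1)).toReal :=
    ENNReal.toReal_pos (Metric.measure_ball_pos volume _ one_pos).ne' hfin
  have hd0 : (d : ℝ) ≠ 0 := by exact_mod_cast (by omega : d ≠ 0)
  have hr : (unitVolumeRadius d) ^ d = (volume (Metric.ball (0 : Space d) 1)).toReal⁻¹ := by
    rw [unitVolumeRadius, ← Real.rpow_natCast, ← Real.rpow_mul hpos.le, neg_mul,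
      one_div_mul_cancel hd0, Real.rpow_neg_one]
  have hr0 : 0 < unitVolumeRadius d := Real.rpow_pos_of_pos hpos _
  rw [Measure.addHaar_ball_of_pos _ _ hr0, finrank_euclideanSpace_fin,
    hr, ENNReal.ofReal_inv_of_pos hpos, ENNReal.ofReal_toReal hfin]
  exact ENNReal.inv_mul_cancel (Metric.measure_ball_pos volume _ one_pos).ne' hfin

/-- The intensity of the ground process: the expected number of points in a Euclidean ball of
unit volume. -/
def intensity (P : Measure Ω) (R : Ω → MarkedConfig d) : ℝ≥0∞ :=
  ∫⁻ ω, (((R ω).points ∩ Metric.ball 0 (unitVolumeRadius d)).encard : ℝ≥0∞) ∂P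

/-- The mean of a law on `ℕ`. -/
def mean (ν : Measure ℕ) : ℝ≥0∞ := ∫⁻ k, (k : ℝ≥0∞) ∂ν

/-- The σ-algebra on `Ω` generated by the ground process (by the numbers of points in Borel
subsets of `ℝ^d`). -/
abbrev groundSigma (R : Ω → MarkedConfig d) : MeasurableSpace Ω :=
  MeasurableSpace.comap (fun ω => (Measure.count.restrict (R ω).points : Measure (Space d)))
    inferInstance

/-- Conditionally on the ground process, the marks of the points are i.i.d. with law `ν`: the
conditional law of the marked configuration given its set of points is the law of the
configuration on these points whose marks are drawn from the product of copies of `ν`. -/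
def HasIIDMarks (P : Measure Ω) (R : Ω → MarkedConfig d) (ν : Measure ℕ)
    [IsProbabilityMeasure ν] : Prop :=
  ∀ C : Set (MarkedConfig d), MeasurableSet C →
    P[(R ⁻¹' C).indicator (fun _ => (1 : ℝ)) | groundSigma R] =ᵐ[P]
      fun ω => (Measure.infinitePi fun _ : (R ω).points => ν).real {f | (R ω).remark f ∈ C}

end Processes

section Geometry

variable {d : ℕ}

/-- No two distinct distances coincide: `|x - y| ≠ |x - z|` for distinct `x, y, z ∈ S`, and
`|x - y| ≠ |u - w|` for distinct `x, y, u, w ∈ S`. -/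
def NonEquidistant (S : Set (Space d)) : Prop :=
  (∀ x ∈ S, ∀ y ∈ S, ∀ z ∈ S, x ≠ y → x ≠ z → y ≠ z → dist x y ≠ dist x z) ∧
  (∀ x ∈ S, ∀ y ∈ S, ∀ u ∈ S, ∀ w ∈ S,
    x ≠ y → x ≠ u → x ≠ w → y ≠ u → y ≠ w → u ≠ w → dist x y ≠ dist u w)

/-- A descending chain in `S`: an infinite sequence of points of `S` whose consecutive distances
are strictly decreasing. -/
def IsDescendingChain (S : Set (Space d)) (x : ℕ → Space d) : Prop :=
  (∀ i, x i ∈ S) ∧ StrictAnti fun i => dist (x (i + 1)) (x i)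

end Geometry

section Matching

variable {d : ℕ}

/-- A set of edges between red and blue points. The edge between the red point `x` and the blue
point `y` is the pair `(x, y)`, red end first; being a set, it has no multiple edges. -/
abbrev EdgeSet (d : ℕ) : Type := Set (Space d × Space d)

/-- The number of edges at the red point `x`. -/
def redDegree (M : EdgeSet d) (x : Space d) : ℕ∞ := {y | (x, y) ∈ M}.encard

/-- The number of edges at the blue point `y`. -/
def blueDegree (M : EdgeSet d) (y : Space d) : ℕ∞ := {x | (x, y) ∈ M}.encard

/-- All stubs of all red points are used up. -/
def ExhaustsRed (r : MarkedConfig d) (M : EdgeSet d) : Prop :=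
  ∀ x ∈ r.points, redDegree M x = r.stubs x

/-- All stubs of all blue points are used up. -/
def ExhaustsBlue (b : MarkedConfig d) (M : EdgeSet d) : Prop :=
  ∀ y ∈ b.points, blueDegree M y = b.stubs y

/-- Two-color partial multi-matching of the red configuration `r` and the blue configuration
`b`: every point has at most as many edges as stubs. -/
structure IsPartialMultiMatching (r b : MarkedConfig d) (M : EdgeSet d) : Prop where
  subset : M ⊆ r.points ×ˢ b.points
  redDegree_le : ∀ x ∈ r.points, redDegree M x ≤ r.stubs x
  blueDegree_le : ∀ y ∈ b.points, blueDegree M y ≤ b.stubs y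

/-- Two-color multi-matching: every point has exactly as many edges as stubs. -/
structure IsMultiMatching (r b : MarkedConfig d) (M : EdgeSet d) : Prop where
  subset : M ⊆ r.points ×ˢ b.points
  exhaustsRed : ExhaustsRed r M
  exhaustsBlue : ExhaustsBlue b M

/-- Stability of a multi-matching: any red `x` and blue `y` are linked by an edge, or at least one
of them has no edge longer than `|x - y|`. -/
def IsStable (r b : MarkedConfig d) (M : EdgeSet d) : Prop :=
  ∀ x ∈ r.points, ∀ y ∈ b.points,
    (x, y) ∈ M ∨ (∀ y', (x, y') ∈ M → dist x y' ≤ dist x y) ∨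
      (∀ x', (x', y) ∈ M → dist x' y ≤ dist x y)

/-- Stability of a partial multi-matching: any red `x` and blue `y` are linked by an edge, or at
least one of them has no unmatched stub and no edge longer than `|x - y|` (an unmatched stub counts
as an edge of infinite length). For multi-matchings this is `IsStable`, and it always implies it. -/
def IsPartialStable (r b : MarkedConfig d) (M : EdgeSet d) : Prop :=
  ∀ x ∈ r.points, ∀ y ∈ b.points,
    (x, y) ∈ M ∨
      (redDegree M x = r.stubs x ∧ ∀ y', (x, y') ∈ M → dist x y' ≤ dist x y) ∨
      (blueDegree M y = b.stubs y ∧ ∀ x', (x', y) ∈ M → dist x' y ≤ dist x y)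

/-- Given the edges `M` created so far: the red `x` and the blue `y` both still have a stub, and no
edge has been created between them. -/
def Compatible (r b : MarkedConfig d) (M : EdgeSet d) (x y : Space d) : Prop :=
  x ∈ r.points ∧ y ∈ b.points ∧ redDegree M x < r.stubs x ∧ blueDegree M y < b.stubs y ∧
    (x, y) ∉ M

/-- Given the edges `M` created so far: `x` and `y` are compatible, `y` is the closest point among
those compatible with `x`, and `x` is the closest point among those compatible with `y`. -/
def MutuallyClosest (r b : MarkedConfig d) (M : EdgeSet d) (x y : Space d) : Prop :=
  Compatible r b M x y ∧
    (∀ y', Compatible r b M x y' → y' ≠ y → dist x y < dist x y') ∧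
    (∀ x', Compatible r b M x' y → x' ≠ x → dist x y < dist x' y)

/-- The edges created in the first `n` steps of the two-color iterated mutually closest matching
algorithm. -/
def cimcStep (r b : MarkedConfig d) : ℕ → EdgeSet d
  | 0 => ∅
  | n + 1 => cimcStep r b n ∪ {p | MutuallyClosest r b (cimcStep r b n) p.1 p.2}

/-- The limiting graph of the algorithm, after infinitely many steps. -/
def cimc (r b : MarkedConfig d) : EdgeSet d := ⋃ n, cimcStep r b n

/-- Translation of a set of edges by `v`. -/
def translateEdges (v : Space d) (M : EdgeSet d) : EdgeSet d :=
  (fun p : Space d × Space d => (v + p.1, v + p.2)) '' M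

/-- The counting measure of a set of edges. -/
def edgeMeasure (M : EdgeSet d) : Measure (Space d × Space d) := Measure.count.restrict M

end Matching

section Schemes

variable {d : ℕ} {Ω : Type*} [MeasurableSpace Ω]

/-- A translation-invariant point process on the space of edges: the number of edges in each
Borel set is measurable, and the law of the process is invariant under all translations. -/
structure IsInvariantEdgeProcess (P : Measure Ω) (M : Ω → EdgeSet d) : Prop where
  measurable : Measurable fun ω => edgeMeasure (M ω)
  invariant : ∀ v : Space d,
    P.map (fun ω => edgeMeasure (translateEdges v (M ω))) = P.map (fun ω => edgeMeasure (M ω))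

/-- Translation-invariant two-color stable multi-matching scheme. -/
structure IsStableScheme (P : Measure Ω) (R B : Ω → MarkedConfig d) (M : Ω → EdgeSet d) :
    Prop where
  process : IsInvariantEdgeProcess P M
  matching : ∀ᵐ ω ∂P, IsMultiMatching (R ω) (B ω) (M ω)
  stable : ∀ᵐ ω ∂P, IsStable (R ω) (B ω) (M ω)

/-- Translation-invariant two-color partial stable multi-matching scheme. -/
structure IsPartialStableScheme (P : Measure Ω) (R B : Ω → MarkedConfig d) (M : Ω → EdgeSet d) :
    Prop where
  process : IsInvariantEdgeProcess P M
  matching : ∀ᵐ ω ∂P, IsPartialMultiMatching (R ω) (B ω) (M ω)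
  stable : ∀ᵐ ω ∂P, IsPartialStable (R ω) (B ω) (M ω)

end Schemes

end TwoColor

end

/-!
Fix a realization. The algorithm gives a point at most one edge per step, so degrees never exceed
the numbers of stubs and each point has received all its edges after finitely many steps. A pair
that stayed compatible forever would, by iterating nearest compatible neighbors, produce a
descending chain or a pair that is mutually closest in the limiting graph
(`exists_reciprocal_nearest`). By local finiteness the latter is mutually closest already after
finitely many steps and so gets linked. Hence no pair stays compatible forever
(`not_compatible_cimc`), and since edges at each point are created in order of increasing length
this gives stability (`isPartialStable_cimc`). A stable multi-matching contains the edges of every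
step by induction, so when the algorithm exhausts the red stubs the output is the only one
(`IsMultiMatching.eq_cimc`).

Which stubs are exhausted is decided by stationarity. Unmatched points of different colors are
linked, so if both colors had unmatched points there would be finitely many of each, and a
stationary point process is almost surely empty or infinite (`ae_unmatched_empty_or_infinite`). By
ergodicity, some color therefore has almost surely no unmatched point. The expected numbers of edges
at red and at blue points of a ball of unit volume agree (`lintegral_mass_transport`), while the
expected numbers of stubs are the stub intensities (`HasIIDMarks.lintegral_stubCount`). Comparing
them shows that the color with the smaller stub intensity is exhausted (`ae_unmatched_eq_empty`);
with equal intensities this applies to both colors.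

Measurability rests on one fact: the counting measures of the configurations form an s-finite
kernel, so that sums over points of jointly measurable functions are jointly measurable. Every rule
of the algorithm is expressed by such sums (`measurableSet_cimc`).
-/

namespace TwoColor

open ProbabilityTheory

section Deterministic

variable {d : ℕ} {r b : MarkedConfig d}

/-! ### Exchanging the two colors -/

theorem compatible_swap {M : EdgeSet d} {x y : Space d} :
    Compatible b r (Prod.swap ⁻¹' M) y x ↔ Compatible r b M x y :=
  ⟨fun h => ⟨h.2.1, h.1, h.2.2.2.1, h.2.2.1, h.2.2.2.2⟩,
    fun h => ⟨h.2.1, h.1, h.2.2.2.1, h.2.2.1, h.2.2.2.2⟩⟩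

theorem mutuallyClosest_swap {M : EdgeSet d} {x y : Space d} :
    MutuallyClosest b r (Prod.swap ⁻¹' M) y x ↔ MutuallyClosest r b M x y := by
  simp only [MutuallyClosest, compatible_swap, dist_comm _ x, dist_comm y]
  tauto

theorem cimcStep_swap (r b : MarkedConfig d) (n : ℕ) :
    cimcStep b r n = Prod.swap ⁻¹' cimcStep r b n := by
  induction n with
  | zero => rfl
  | succ n ih =>
    ext ⟨y, x⟩
    simp only [cimcStep, ih, mem_union, mem_ofPred_eq, mem_preimage, Prod.swap_prod_mk,
      mutuallyClosest_swap]

theorem cimc_swap (r b : MarkedConfig d) : cimc b r = Prod.swap ⁻¹' cimc r b := by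
  simp only [cimc, preimage_iUnion, cimcStep_swap r b]

theorem blueDegree_cimc (r b : MarkedConfig d) (y : Space d) :
    blueDegree (cimc r b) y = redDegree (cimc b r) y := by
  rw [cimc_swap r b]; rfl

/-! ### The graph produced by the algorithm -/

theorem redDegree_mono {M N : EdgeSet d} (h : M ⊆ N) (x : Space d) :
    redDegree M x ≤ redDegree N x :=
  encard_le_encard fun _ hy => h hy

theorem blueDegree_mono {M N : EdgeSet d} (h : M ⊆ N) (y : Space d) :
    blueDegree M y ≤ blueDegree N y :=
  encard_le_encard fun _ hx => h hx

theorem Compatible.anti {M N : EdgeSet d} (h : M ⊆ N) {x y : Space d}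
    (hc : Compatible r b N x y) : Compatible r b M x y :=
  ⟨hc.1, hc.2.1, (redDegree_mono h x).trans_lt hc.2.2.1,
    (blueDegree_mono h y).trans_lt hc.2.2.2.1, fun hM => hc.2.2.2.2 (h hM)⟩

theorem MutuallyClosest.right_unique {M : EdgeSet d} {x y y' : Space d}
    (h : MutuallyClosest r b M x y) (h' : MutuallyClosest r b M x y') : y' = y := by
  by_contra hne
  exact lt_asymm (h.2.1 y' h'.1 hne) (h'.2.1 y h.1 (Ne.symm hne))

theorem cimcStep_mono (r b : MarkedConfig d) : Monotone (cimcStep r b) :=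
  monotone_nat_of_le_succ fun _ => subset_union_left

theorem cimcStep_subset_cimc (r b : MarkedConfig d) (n : ℕ) : cimcStep r b n ⊆ cimc r b :=
  subset_iUnion _ n

theorem mem_cimc_iff {x y : Space d} :
    (x, y) ∈ cimc r b ↔ ∃ n, MutuallyClosest r b (cimcStep r b n) x y := by
  constructor
  · intro h
    obtain ⟨n, hn⟩ := mem_iUnion.1 h
    induction n with
    | zero => exact hn.elim
    | succ n ih => exact hn.elim ih fun h => ⟨n, h⟩
  · rintro ⟨n, hn⟩
    exact cimcStep_subset_cimc r b (n + 1) (Or.inr hn)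

theorem cimc_subset (r b : MarkedConfig d) : cimc r b ⊆ r.points ×ˢ b.points := by
  rintro ⟨x, y⟩ h
  obtain ⟨n, hn⟩ := mem_cimc_iff.1 h
  exact ⟨hn.1.1, hn.1.2.1⟩

theorem cimcStep_subset (r b : MarkedConfig d) (n : ℕ) :
    cimcStep r b n ⊆ r.points ×ˢ b.points :=
  (cimcStep_subset_cimc r b n).trans (cimc_subset r b)

/-- A point receives at most one edge per step, and only while it has a free stub. -/
theorem redDegree_cimcStep_le (r b : MarkedConfig d) (n : ℕ) (x : Space d) :
    redDegree (cimcStep r b n) x ≤ r.stubs x := by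
  induction n with
  | zero => simp [redDegree, cimcStep]
  | succ n ih =>
    have hrow : {y | (x, y) ∈ cimcStep r b (n + 1)} =
        {y | (x, y) ∈ cimcStep r b n} ∪ {y | MutuallyClosest r b (cimcStep r b n) x y} := rfl
    have hsub : {y | MutuallyClosest r b (cimcStep r b n) x y}.Subsingleton :=
      fun y hy y' hy' => hy'.right_unique hy
    rw [redDegree, hrow]
    rcases hsub.eq_empty_or_singleton with h | ⟨y, h⟩
    · rw [h, union_empty]; exact ih
    · have hy : MutuallyClosest r b (cimcStep r b n) x y := by
        have : y ∈ {y | MutuallyClosest r b (cimcStep r b n) x y} := h ▸ mem_singleton y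
        exact this
      refine (encard_union_le _ _).trans ?_
      rw [h, encard_singleton]
      exact Order.add_one_le_of_lt hy.1.2.2.1

/-- Every point receives all its edges within finitely many steps. -/
theorem exists_forall_mem_cimcStep (r b : MarkedConfig d) (x : Space d) :
    ∃ n, ∀ y, (x, y) ∈ cimc r b → (x, y) ∈ cimcStep r b n := by
  set row : ℕ → Set (Space d) := fun n => {y | (x, y) ∈ cimcStep r b n} with hrow
  have hle : ∀ n, (row n).encard ≤ r.stubs x := fun n => redDegree_cimcStep_le r b n x
  have hfin : ∀ n, (row n).Finite := fun n => finite_of_encard_le_coe (hle n)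
  have hmono : Monotone row := fun m n hmn y hy => cimcStep_mono r b hmn hy
  have hbdd : BddAbove (range fun n => (row n).ncard) := by
    refine ⟨r.stubs x, ?_⟩
    rintro _ ⟨n, rfl⟩
    have := hle n
    rw [← (hfin n).cast_ncard_eq] at this
    exact_mod_cast this
  -- a step after which the degree of `x` no longer grows
  obtain ⟨n, hn⟩ := Nat.sSup_mem (range_nonempty fun n => (row n).ncard) hbdd
  refine ⟨n, fun y hy => ?_⟩
  obtain ⟨m, hm⟩ := mem_iUnion.1 hy
  have hcard : (row (max n m)).ncard ≤ (row n).ncard := by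
    have := le_csSup hbdd ⟨max n m, rfl⟩
    rw [← hn] at this
    exact this
  have := Set.eq_of_subset_of_ncard_le (hmono (le_max_left n m)) hcard (hfin _)
  change y ∈ row n
  rw [this]
  exact hmono (le_max_right n m) hm

theorem exists_redDegree_cimcStep_eq (r b : MarkedConfig d) (x : Space d) :
    ∃ n, redDegree (cimcStep r b n) x = redDegree (cimc r b) x := by
  obtain ⟨n, hn⟩ := exists_forall_mem_cimcStep r b x
  exact ⟨n, le_antisymm (redDegree_mono (cimcStep_subset_cimc r b n) x) (encard_le_encard hn)⟩

theorem exists_blueDegree_cimcStep_eq (r b : MarkedConfig d) (y : Space d) :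
    ∃ n, blueDegree (cimcStep r b n) y = blueDegree (cimc r b) y := by
  obtain ⟨n, hn⟩ := exists_redDegree_cimcStep_eq b r y
  rw [cimcStep_swap r b, cimc_swap r b] at hn
  exact ⟨n, hn⟩

theorem redDegree_cimc_le (r b : MarkedConfig d) (x : Space d) :
    redDegree (cimc r b) x ≤ r.stubs x := by
  obtain ⟨n, hn⟩ := exists_redDegree_cimcStep_eq r b x
  exact hn ▸ redDegree_cimcStep_le r b n x

theorem blueDegree_cimc_le (r b : MarkedConfig d) (y : Space d) :
    blueDegree (cimc r b) y ≤ b.stubs y :=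
  blueDegree_cimc r b y ▸ redDegree_cimc_le b r y

theorem isPartialMultiMatching_cimc (r b : MarkedConfig d) :
    IsPartialMultiMatching r b (cimc r b) :=
  ⟨cimc_subset r b, fun x _ => redDegree_cimc_le r b x, fun y _ => blueDegree_cimc_le r b y⟩

theorem compatible_cimc_of_forall {x y : Space d}
    (h : ∀ n, Compatible r b (cimcStep r b n) x y) : Compatible r b (cimc r b) x y := by
  obtain ⟨m, hm⟩ := exists_redDegree_cimcStep_eq r b x
  obtain ⟨n, hn⟩ := exists_blueDegree_cimcStep_eq r b y
  refine ⟨(h 0).1, (h 0).2.1, hm ▸ (h m).2.2.1, hn ▸ (h n).2.2.2.1, fun hM => ?_⟩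
  obtain ⟨k, hk⟩ := mem_iUnion.1 hM
  exact (h k).2.2.2.2 hk

theorem eventually_not_compatible {x y : Space d} (h : ¬ Compatible r b (cimc r b) x y) :
    ∀ᶠ n in Filter.atTop, ¬ Compatible r b (cimcStep r b n) x y := by
  obtain ⟨m, hm⟩ := not_forall.1 (mt compatible_cimc_of_forall h)
  filter_upwards [Filter.eventually_ge_atTop m] with n hn hc
  exact hm (hc.anti (cimcStep_mono r b hn))

/-! ### Reciprocal nearest neighbors -/

/-- In a symmetric, locally finite relation between points of a set with distinct distances and no
descending chain, some related pair is mutually closest: otherwise passing from each point to its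
nearest related point yields a descending chain. The index type `V` allows the same location to
occur several times. -/
theorem exists_reciprocal_nearest {V : Type*} (pos : V → Space d) (A : V → V → Prop)
    (hsymm : ∀ v w, A v w → A w v) {S : Set (Space d)} (hS : ∀ v w, A v w → pos v ∈ S)
    (hfin : ∀ v (ρ : ℝ), {w | A v w ∧ dist (pos v) (pos w) ≤ ρ}.Finite)
    (hne : ∀ v w w', A v w → A v w' → w ≠ w' → dist (pos v) (pos w) ≠ dist (pos v) (pos w'))
    (hchain : ¬ ∃ x : ℕ → Space d, IsDescendingChain S x) {v₀ w₀ : V} (h₀ : A v₀ w₀) :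
    ∃ v w, A v w ∧ (∀ w', A v w' → w' ≠ w → dist (pos v) (pos w) < dist (pos v) (pos w')) ∧
      (∀ v', A v' w → v' ≠ v → dist (pos v) (pos w) < dist (pos v') (pos w)) := by
  have hnear : ∀ v, (∃ w, A v w) → ∃ w, A v w ∧
      ∀ w', A v w' → w' ≠ w → dist (pos v) (pos w) < dist (pos v) (pos w') := by
    rintro v ⟨w, hw⟩
    obtain ⟨u, hu, hmin⟩ := exists_min_image _ (fun u => dist (pos v) (pos u))
      (hfin v (dist (pos v) (pos w))) ⟨w, hw, le_rfl⟩
    refine ⟨u, hu.1, fun w' hw' hne' => ?_⟩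
    refine lt_of_le_of_ne ?_ (hne v u w' hu.1 hw' hne'.symm)
    by_cases hle : dist (pos v) (pos w') ≤ dist (pos v) (pos w)
    · exact hmin w' ⟨hw', hle⟩
    · exact hu.2.trans (not_le.1 hle).le
  choose! f hf hfmin using hnear
  by_contra! hcon
  have hstep : ∀ n, A (f^[n] v₀) (f^[n + 1] v₀) := by
    intro n
    induction n with
    | zero => exact hf v₀ ⟨w₀, h₀⟩
    | succ n ih =>
      rw [Function.iterate_succ_apply' f (n + 1)]
      exact hf _ ⟨_, hsymm _ _ ih⟩
  refine hchain ⟨fun n => pos (f^[n] v₀), fun n => hS _ _ (hstep n),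
    strictAnti_nat_of_succ_lt fun n => ?_⟩
  set v := f^[n] v₀
  have h1 : f^[n + 1] v₀ = f v := Function.iterate_succ_apply' f n v₀
  have h2 : f^[n + 1 + 1] v₀ = f (f v) := by
    rw [Function.iterate_succ_apply' f (n + 1), h1]
  have hv : A v (f v) := h1 ▸ hstep n
  have hfv : ∃ w, A (f v) w := ⟨v, hsymm _ _ hv⟩
  simp only [h1, h2]
  obtain ⟨v', hv', hne', hle⟩ := hcon v (f v) hv (hfmin v ⟨_, hv⟩)
  have hlt : dist (pos (f v)) (pos (f (f v))) < dist (pos (f v)) (pos v) := by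
    by_cases hvv : v = f (f v)
    · have := hfmin (f v) hfv v' (hsymm _ _ hv') (hvv ▸ hne')
      rw [← hvv, dist_comm, dist_comm _ (pos v')] at this
      exact absurd hle (not_le.2 this)
    · exact hfmin (f v) hfv v (hsymm _ _ hv) hvv
  rwa [dist_comm]

theorem NonEquidistant.dist_ne {S : Set (Space d)} (h : NonEquidistant S) {x y z : Space d}
    (hx : x ∈ S) (hy : y ∈ S) (hz : z ∈ S) (hyz : y ≠ z) : dist x y ≠ dist x z := by
  by_cases hxy : x = y
  · subst hxy
    rw [dist_self]
    exact (dist_pos.2 hyz).ne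
  · by_cases hxz : x = z
    · subst hxz
      rw [dist_self]
      exact (dist_pos.2 hxy).ne'
    · exact h.1 x hx y hy z hz hxy hxz hyz

theorem finite_points_inter_dist_le (c : MarkedConfig d) (x : Space d) (ρ : ℝ) :
    {y | y ∈ c.points ∧ dist x y ≤ ρ}.Finite :=
  (c.locallyFinite _ (Metric.isBounded_closedBall (x := x) (r := ρ))).subset
    fun y hy => ⟨hy.1, by rw [Metric.mem_closedBall, dist_comm]; exact hy.2⟩

theorem exists_mutuallyClosest (hS : NonEquidistant (r.points ∪ b.points))
    (hchain : ¬ ∃ x : ℕ → Space d, IsDescendingChain (r.points ∪ b.points) x)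
    {M : EdgeSet d} {x₀ y₀ : Space d} (h₀ : Compatible r b M x₀ y₀) :
    ∃ x y, MutuallyClosest r b M x y := by
  let A : Space d ⊕ Space d → Space d ⊕ Space d → Prop
    | .inl x, .inr y => Compatible r b M x y
    | .inr y, .inl x => Compatible r b M x y
    | _, _ => False
  have hA := exists_reciprocal_nearest (Sum.elim id id) A (S := r.points ∪ b.points)
    (v₀ := .inl x₀) (w₀ := .inr y₀) ?_ ?_ ?_ ?_ hchain h₀
  · obtain ⟨v, w, h, h1, h2⟩ := hA
    match v, w, h, h1, h2 with
    | .inl x, .inr y, h, h1, h2 =>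
      exact ⟨x, y, h, fun y' hy' hne => h1 (.inr y') hy' (by simpa using hne),
        fun x' hx' hne => h2 (.inl x') hx' (by simpa using hne)⟩
    | .inr y, .inl x, h, h1, h2 =>
      refine ⟨x, y, h, fun y' hy' hne => ?_, fun x' hx' hne => ?_⟩
      · have := h2 (.inr y') hy' (by simpa using hne)
        simpa [dist_comm] using this
      · have := h1 (.inl x') hx' (by simpa using hne)
        simpa [dist_comm] using this
  · rintro (v | v) (w | w) h <;> exact h
  · rintro (v | v) (w | w) h
    · exact h.elim
    · exact Or.inl h.1
    · exact Or.inr h.2.1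
    · exact h.elim
  · rintro (v | v) ρ
    · refine ((finite_points_inter_dist_le b v ρ).image Sum.inr).subset ?_
      rintro (w | w) ⟨h, hd⟩
      · exact h.elim
      · exact ⟨w, ⟨h.2.1, hd⟩, rfl⟩
    · refine ((finite_points_inter_dist_le r v ρ).image Sum.inl).subset ?_
      rintro (w | w) ⟨h, hd⟩
      · exact ⟨w, ⟨h.1, hd⟩, rfl⟩
      · exact h.elim
  · rintro (v | v) (w | w) (w' | w') h h' hne
    all_goals first
      | exact h.elim
      | exact h'.elim
      | exact hS.dist_ne (Or.inl h.1) (Or.inr h.2.1) (Or.inr h'.2.1) (by simpa using hne)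
      | exact hS.dist_ne (Or.inr h.2.1) (Or.inl h.1) (Or.inl h'.1) (by simpa using hne)

/-! ### Stability and uniqueness -/

/-- No pair stays compatible forever: a mutually closest pair of the limiting graph is mutually
closest already after finitely many steps, because only finitely many points are closer. -/
theorem not_compatible_cimc (hS : NonEquidistant (r.points ∪ b.points))
    (hchain : ¬ ∃ x : ℕ → Space d, IsDescendingChain (r.points ∪ b.points) x)
    (x y : Space d) : ¬ Compatible r b (cimc r b) x y := by
  intro h₀
  obtain ⟨x, y, h⟩ := exists_mutuallyClosest hS hchain h₀
  have hred : ∀ᶠ n in Filter.atTop, ∀ y' ∈ {y' | y' ∈ b.points ∧ dist x y' ≤ dist x y},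
      y' ≠ y → ¬ Compatible r b (cimcStep r b n) x y' := by
    refine (Filter.eventually_all_finite (finite_points_inter_dist_le b x _)).2 fun y' hy' => ?_
    by_cases hne : y' = y
    · exact Filter.Eventually.of_forall fun n h => absurd hne h
    · filter_upwards [eventually_not_compatible
        fun hc => (h.2.1 y' hc hne).not_ge hy'.2] with n hn _ using hn
  have hblue : ∀ᶠ n in Filter.atTop, ∀ x' ∈ {x' | x' ∈ r.points ∧ dist y x' ≤ dist x y},
      x' ≠ x → ¬ Compatible r b (cimcStep r b n) x' y := by
    refine (Filter.eventually_all_finite (finite_points_inter_dist_le r y _)).2 fun x' hx' => ?_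
    by_cases hne : x' = x
    · exact Filter.Eventually.of_forall fun n h => absurd hne h
    · filter_upwards [eventually_not_compatible
        fun hc => (h.2.2 x' hc hne).not_ge (dist_comm y x' ▸ hx'.2)] with n hn _ using hn
  obtain ⟨n, hn1, hn2⟩ := (hred.and hblue).exists
  refine h.1.2.2.2.2 (mem_cimc_iff.2 ⟨n, h.1.anti (cimcStep_subset_cimc r b n), ?_, ?_⟩)
  · intro y' hy' hne
    by_contra hlt
    exact hn1 y' ⟨hy'.2.1, not_lt.1 hlt⟩ hne hy'
  · intro x' hx' hne
    by_contra hlt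
    exact hn2 x' ⟨hx'.1, dist_comm y x' ▸ not_lt.1 hlt⟩ hne hx'

theorem isPartialStable_cimc (hS : NonEquidistant (r.points ∪ b.points))
    (hchain : ¬ ∃ x : ℕ → Space d, IsDescendingChain (r.points ∪ b.points) x) :
    IsPartialStable r b (cimc r b) := by
  intro x hx y hy
  by_contra! hcon
  obtain ⟨hxy, hx', hy'⟩ := hcon
  -- a point with an edge longer than `dist x y` shows that its partner was full at that time
  have hxlong : ∀ z, (x, z) ∈ cimc r b → dist x y < dist x z → ∃ n,
      redDegree (cimcStep r b n) x < r.stubs x ∧ blueDegree (cimcStep r b n) y = b.stubs y := by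
    intro z hz hlt
    obtain ⟨n, hn⟩ := mem_cimc_iff.1 hz
    refine ⟨n, hn.1.2.2.1, ?_⟩
    by_contra hfull
    have hc : Compatible r b (cimcStep r b n) x y :=
      ⟨hx, hy, hn.1.2.2.1, lt_of_le_of_ne ((blueDegree_mono (cimcStep_subset_cimc r b n) y).trans
        (blueDegree_cimc_le r b y)) hfull, fun h => hxy (cimcStep_subset_cimc r b n h)⟩
    exact lt_asymm hlt (hn.2.1 y hc (by rintro rfl; exact lt_irrefl _ hlt))
  have hylong : ∀ z, (z, y) ∈ cimc r b → dist x y < dist z y → ∃ n,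
      blueDegree (cimcStep r b n) y < b.stubs y ∧ redDegree (cimcStep r b n) x = r.stubs x := by
    intro z hz hlt
    obtain ⟨n, hn⟩ := mem_cimc_iff.1 hz
    refine ⟨n, hn.1.2.2.2.1, ?_⟩
    by_contra hfull
    have hc : Compatible r b (cimcStep r b n) x y :=
      ⟨hx, hy, lt_of_le_of_ne (redDegree_cimcStep_le r b n x) hfull, hn.1.2.2.2.1,
        fun h => hxy (cimcStep_subset_cimc r b n h)⟩
    exact lt_asymm hlt (hn.2.2 x hc (by rintro rfl; exact lt_irrefl _ hlt))
  by_cases hxfull : redDegree (cimc r b) x = r.stubs x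
  · obtain ⟨z, hz, hlt⟩ := hx' hxfull
    obtain ⟨n, hxn, hyn⟩ := hxlong z hz hlt
    have hyfull : blueDegree (cimc r b) y = b.stubs y :=
      le_antisymm (blueDegree_cimc_le r b y)
        (hyn ▸ blueDegree_mono (cimcStep_subset_cimc r b n) y)
    obtain ⟨w, hw, hlt'⟩ := hy' hyfull
    obtain ⟨m, hym, hxm⟩ := hylong w hw hlt'
    rcases le_total m n with hmn | hmn
    · exact (redDegree_mono (cimcStep_mono r b hmn) x).not_gt (hxm ▸ hxn)
    · exact (blueDegree_mono (cimcStep_mono r b hmn) y).not_gt (hyn ▸ hym)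
  · by_cases hyfull : blueDegree (cimc r b) y = b.stubs y
    · obtain ⟨w, hw, hlt'⟩ := hy' hyfull
      obtain ⟨m, -, hxm⟩ := hylong w hw hlt'
      exact hxfull (le_antisymm (redDegree_cimc_le r b x)
        (hxm ▸ redDegree_mono (cimcStep_subset_cimc r b m) x))
    · exact not_compatible_cimc hS hchain x y ⟨hx, hy,
        lt_of_le_of_ne (redDegree_cimc_le r b x) hxfull,
        lt_of_le_of_ne (blueDegree_cimc_le r b y) hyfull, hxy⟩

theorem IsPartialStable.isStable {M : EdgeSet d} (h : IsPartialStable r b M) :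
    IsStable r b M := fun x hx y hy =>
  (h x hx y hy).imp_right (Or.imp And.right And.right)

/-- If the red end of a mutually closest pair has no longer edge in a graph that uses up its stubs
and contains the edges created so far, then the pair is linked in this graph. -/
theorem MutuallyClosest.mem_of_forall_dist_le {C M : EdgeSet d} {x y : Space d}
    (h : MutuallyClosest r b C x y) (hM : IsMultiMatching r b M) (hCM : C ⊆ M)
    (hle : ∀ y', (x, y') ∈ M → dist x y' ≤ dist x y) : (x, y) ∈ M := by
  by_contra hxy
  have hlt : redDegree C x < redDegree M x := by
    rw [hM.exhaustsRed x h.1.1]; exact h.1.2.2.1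
  obtain ⟨y', hy'M, hy'C⟩ : ∃ y', (x, y') ∈ M ∧ (x, y') ∉ C := by
    by_contra! hcon
    exact hlt.not_ge (encard_le_encard hcon)
  have hy' : y' ∈ b.points := (hM.subset hy'M).2
  have hfin : {x' | (x', y') ∈ C}.Finite := by
    refine finite_of_encard_le_coe (k := b.stubs y') ?_
    exact (blueDegree_mono hCM y').trans (hM.exhaustsBlue y' hy').le
  have hdeg : blueDegree C y' < b.stubs y' := by
    rw [← hM.exhaustsBlue y' hy']
    exact hfin.encard_lt_encard ⟨fun _ hx => hCM hx, fun hsub => hy'C (hsub hy'M)⟩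
  exact (h.2.1 y' ⟨h.1.1, hy', h.1.2.2.1, hdeg, hy'C⟩
    (by rintro rfl; exact hxy hy'M)).not_ge (hle y' hy'M)

theorem IsMultiMatching.swap {M : EdgeSet d} (h : IsMultiMatching r b M) :
    IsMultiMatching b r (Prod.swap ⁻¹' M) :=
  ⟨fun _ hp => ⟨(h.subset hp).2, (h.subset hp).1⟩, h.exhaustsBlue, h.exhaustsRed⟩

theorem cimcStep_subset_of_isStable {M : EdgeSet d} (hM : IsMultiMatching r b M)
    (hs : IsStable r b M) (n : ℕ) : cimcStep r b n ⊆ M := by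
  induction n with
  | zero => exact empty_subset _
  | succ n ih =>
    refine union_subset ih ?_
    rintro ⟨x, y⟩ (h : MutuallyClosest r b (cimcStep r b n) x y)
    rcases hs x h.1.1 y h.1.2.1 with hmem | hx | hy
    · exact hmem
    · exact h.mem_of_forall_dist_le hM ih hx
    · refine (mutuallyClosest_swap.2 h).mem_of_forall_dist_le hM.swap (preimage_mono ih)
        fun x' hx' => ?_
      rw [dist_comm, dist_comm y]
      exact hy x' hx'

theorem IsMultiMatching.eq_cimc {M : EdgeSet d} (hM : IsMultiMatching r b M)
    (hs : IsStable r b M) (hred : ExhaustsRed r (cimc r b)) : M = cimc r b := by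
  refine Subset.antisymm ?_ (iUnion_subset (cimcStep_subset_of_isStable hM hs))
  rintro ⟨x, y⟩ hxy
  have hx := (hM.subset hxy).1
  have hfin : {y | (x, y) ∈ M}.Finite :=
    finite_of_encard_le_coe (hM.exhaustsRed x hx).le
  have hsub : {y | (x, y) ∈ cimc r b} ⊆ {y | (x, y) ∈ M} := fun _ h =>
    iUnion_subset (cimcStep_subset_of_isStable hM hs) h
  have heq := (hfin.subset hsub).eq_of_subset_of_encard_le hsub
    ((hM.exhaustsRed x hx).trans (hred x hx).symm).le
  exact (Set.ext_iff.1 heq y).2 hxy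

/-! ### Points with unmatched stubs -/

/-- The points of `r` that keep an unmatched stub when the algorithm is run on `r` and `b`, with
`r` as the red configuration; by `cimc_swap` the exchanged arguments give the blue points. -/
def unmatched (r b : MarkedConfig d) : Set (Space d) :=
  {x | redDegree (cimc r b) x < r.stubs x}

theorem unmatched_subset (r b : MarkedConfig d) : unmatched r b ⊆ r.points := by
  rintro x hx h0
  have hx' : redDegree (cimc r b) x < r.stubs x := hx
  simp [h0] at hx'

theorem exhaustsRed_cimc (h : unmatched r b = ∅) : ExhaustsRed r (cimc r b) := fun x _ =>
  le_antisymm (redDegree_cimc_le r b x) (not_lt.1 fun hx => (h ▸ hx : x ∈ (∅ : Set (Space d))))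

theorem exhaustsBlue_cimc (h : unmatched b r = ∅) : ExhaustsBlue b (cimc r b) := fun y hy =>
  (blueDegree_cimc r b y).trans (exhaustsRed_cimc h y hy)

/-- Unmatched points of different colors are linked, so that an unmatched blue point bounds the
number of unmatched red points by its degree. -/
theorem finite_unmatched (hS : NonEquidistant (r.points ∪ b.points))
    (hchain : ¬ ∃ x : ℕ → Space d, IsDescendingChain (r.points ∪ b.points) x)
    (h : (unmatched b r).Nonempty) : (unmatched r b).Finite := by
  obtain ⟨y, hy⟩ := h
  have hfin : {x | (x, y) ∈ cimc r b}.Finite := finite_of_encard_le_coe (blueDegree_cimc_le r b y)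
  refine hfin.subset fun x hx => ?_
  by_contra hxy
  refine not_compatible_cimc hS hchain x y ⟨unmatched_subset r b hx, unmatched_subset b r hy, hx,
    ?_, hxy⟩
  rw [blueDegree_cimc]
  exact hy

end Deterministic

variable {d : ℕ}

/-! ### Counting kernels -/

/-- A kernel whose measures are all finite on the sets of one countable measurable cover is
s-finite: the cells on which the measure of a given set lies in `[k, k + 1)` split it into finite
kernels. -/
theorem isSFiniteKernel_of_cover {α β : Type*} [MeasurableSpace α] [MeasurableSpace β]
    (κ : Kernel α β) (s : ℕ → Set β) (hs : ∀ n, MeasurableSet (s n)) (hcover : ⋃ n, s n = univ)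
    (hfin : ∀ a n, κ a (s n) < ∞) : IsSFiniteKernel κ := by
  classical
  set t := disjointed s with ht
  have htm : ∀ n, MeasurableSet (t n) := fun n => MeasurableSet.disjointed hs n
  have htfin : ∀ a n, κ a (t n) < ∞ := fun a n =>
    (measure_mono (disjointed_subset s n)).trans_lt (hfin a n)
  have hcell : ∀ n k, MeasurableSet {a | ⌊(κ a (t n)).toReal⌋₊ = k} := fun n k =>
    (Nat.measurable_floor.comp (κ.measurable_coe (htm n)).ennreal_toReal)
      (measurableSet_singleton k)
  let η : ℕ → ℕ → Kernel α β := fun n k => Kernel.piecewise (hcell n k) (κ.restrict (htm n)) 0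
  have hη : ∀ n k, IsFiniteKernel (η n k) := by
    refine fun n k => ⟨⟨k + 1, by simp, fun a => ?_⟩⟩
    simp only [η, Kernel.piecewise_apply]
    split_ifs with h
    · rw [Kernel.restrict_apply, Measure.restrict_apply_univ,
        ← ENNReal.ofReal_toReal (htfin a n).ne]
      have h' : ⌊(κ a (t n)).toReal⌋₊ = k := h
      have := (Nat.lt_floor_add_one (κ a (t n)).toReal).le
      rw [h'] at this
      refine (ENNReal.ofReal_le_ofReal this).trans ?_
      rw [ENNReal.ofReal_add (by positivity) zero_le_one]
      simp
    · simp
  have hsum : κ = Kernel.sum fun n => Kernel.sum fun k => η n k := by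
    ext a A hA
    rw [Kernel.sum_apply' _ a hA]
    have h1 : ∀ n, Kernel.sum (fun k => η n k) a A = κ a (A ∩ t n) := by
      intro n
      rw [Kernel.sum_apply' _ a hA, tsum_eq_single ⌊(κ a (t n)).toReal⌋₊]
      · simp only [η, Kernel.piecewise_apply]
        rw [if_pos (show a ∈ {a' | ⌊(κ a' (t n)).toReal⌋₊ = ⌊(κ a (t n)).toReal⌋₊} from rfl),
          Kernel.restrict_apply, Measure.restrict_apply hA]
      · intro k hk
        simp only [η, Kernel.piecewise_apply]
        rw [if_neg (show a ∉ {a' | ⌊(κ a' (t n)).toReal⌋₊ = k} from fun h => hk (Eq.symm h))]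
        simp
    simp_rw [h1]
    rw [← measure_iUnion (fun i j hij =>
      ((disjoint_disjointed s) hij).mono inter_subset_right inter_subset_right)
      (fun n => hA.inter (htm n)), ← inter_iUnion, iUnion_disjointed, hcover, inter_univ]
  rw [hsum]
  infer_instance

theorem countable_points (c : MarkedConfig d) : c.points.Countable := by
  have h : c.points ⊆ ⋃ n : ℕ, Function.support c.stubs ∩ Metric.closedBall 0 n := by
    intro x hx
    obtain ⟨n, hn⟩ := exists_nat_ge ‖x‖
    exact mem_iUnion.2 ⟨n, hx, mem_closedBall_zero_iff.2 hn⟩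
  exact (countable_iUnion fun n =>
    (c.locallyFinite _ Metric.isBounded_closedBall).countable).mono h

theorem measurableSet_points (c : MarkedConfig d) : MeasurableSet c.points :=
  (countable_points c).measurableSet

theorem countable_graph (c : MarkedConfig d) :
    {p : Space d × ℕ | p.1 ∈ c.points ∧ p.2 = c.stubs p.1}.Countable := by
  refine ((countable_points c).image fun x => (x, c.stubs x)).mono ?_
  rintro p ⟨hx, hk⟩
  exact ⟨p.1, hx, Prod.ext rfl hk.symm⟩

/-- The counting measure of the marked points, as a kernel. -/
noncomputable def markedKernel (d : ℕ) : Kernel (MarkedConfig d) (Space d × ℕ) :=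
  ⟨MarkedConfig.toMeasure, comap_measurable _⟩

theorem lintegral_markedKernel (c : MarkedConfig d) (f : Space d × ℕ → ℝ≥0∞) :
    ∫⁻ p, f p ∂markedKernel d c = ∑' x : c.points, f (x, c.stubs x) := by
  change ∫⁻ p in _, f p ∂Measure.count = _
  rw [lintegral_countable f (countable_graph c)]
  let e : c.points ≃ {p : Space d × ℕ | p.1 ∈ c.points ∧ p.2 = c.stubs p.1} :=
    { toFun := fun x => ⟨(x, c.stubs x), x.2, rfl⟩
      invFun := fun p => ⟨p.1.1, p.2.1⟩
      left_inv := fun x => rfl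
      right_inv := fun p => Subtype.ext (Prod.ext rfl p.2.2.symm) }
  rw [← e.tsum_eq]
  simp [e]

instance : IsSFiniteKernel (markedKernel d) := by
  refine isSFiniteKernel_of_cover _ (fun n => Metric.closedBall 0 n ×ˢ univ)
    (fun n => measurableSet_closedBall.prod MeasurableSet.univ) ?_ fun c n => ?_
  · refine eq_univ_of_forall fun p => ?_
    obtain ⟨n, hn⟩ := exists_nat_ge ‖p.1‖
    exact mem_iUnion.2 ⟨n, mem_closedBall_zero_iff.2 hn, mem_univ _⟩
  · change (Measure.count.restrict _) _ < ∞
    rw [Measure.restrict_apply (measurableSet_closedBall.prod MeasurableSet.univ),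
      Measure.count_apply_lt_top]
    refine ((c.locallyFinite (Metric.closedBall 0 n) Metric.isBounded_closedBall).image
      fun x => (x, c.stubs x)).subset ?_
    rintro p ⟨hx, hxc, hk⟩
    exact ⟨p.1, ⟨hxc, hx.1⟩, Prod.ext rfl hk.symm⟩

/-- The counting measure of the ground process, as a kernel. -/
noncomputable def pointKernel (d : ℕ) : Kernel (MarkedConfig d) (Space d) :=
  (markedKernel d).map Prod.fst

instance : IsSFiniteKernel (pointKernel d) := by unfold pointKernel; infer_instance

theorem pointKernel_apply (c : MarkedConfig d) :
    pointKernel d c = Measure.count.restrict c.points := by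
  ext A hA
  rw [pointKernel, Kernel.map_apply' _ measurable_fst _ hA,
    ← lintegral_indicator_one (measurable_fst hA), lintegral_markedKernel,
    ← lintegral_indicator_one hA, lintegral_countable _ (countable_points c)]
  simp only [Measure.count_singleton, mul_one]
  rfl

theorem lintegral_pointKernel (c : MarkedConfig d) (f : Space d → ℝ≥0∞) :
    ∫⁻ x, f x ∂pointKernel d c = ∑' x : c.points, f x := by
  rw [pointKernel_apply, lintegral_countable _ (countable_points c)]
  simp

theorem ae_pointKernel_iff {c : MarkedConfig d} {p : Space d → Prop} :
    (∀ᵐ x ∂pointKernel d c, p x) ↔ ∀ x ∈ c.points, p x := by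
  rw [pointKernel_apply, ae_restrict_iff' (measurableSet_points c), ae_iff,
    Measure.count_eq_zero_iff]
  simp [Set.eq_empty_iff_forall_notMem]

section Measurability

variable {α : Type*} [MeasurableSpace α]

theorem measurable_lintegral_pointKernel {g : α → MarkedConfig d} (hg : Measurable g)
    {f : α → Space d → ℝ≥0∞} (hf : Measurable (Function.uncurry f)) :
    Measurable fun a => ∫⁻ x, f a x ∂pointKernel d (g a) :=
  Measurable.lintegral_kernel_prod_right (κ := (pointKernel d).comap g hg) hf

/-- A universal statement about the points of a configuration is measurable: it says that the number
of points violating it is zero. -/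
theorem measurableSet_forall_mem_points {g : α → MarkedConfig d} (hg : Measurable g)
    {p : α → Space d → Prop} (hp : MeasurableSet {q : α × Space d | p q.1 q.2}) :
    MeasurableSet {a | ∀ x ∈ (g a).points, p a x} := by
  have hm : Measurable (Function.uncurry fun a x =>
      ({q : α × Space d | p q.1 q.2}ᶜ).indicator (fun _ => (1 : ℝ≥0∞)) (a, x)) :=
    measurable_const.indicator hp.compl
  convert measurable_lintegral_pointKernel hg hm (measurableSet_singleton 0) using 1
  ext a
  simp only [lintegral_pointKernel, mem_preimage, mem_singleton_iff, ENNReal.tsum_eq_zero]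
  simp [indicator]

theorem measurable_stubs :
    Measurable fun p : MarkedConfig d × Space d => (p.1.stubs p.2 : ℝ≥0∞) := by
  have hf : Measurable (Function.uncurry fun (p : MarkedConfig d × Space d) (q : Space d × ℕ) =>
      {z : (MarkedConfig d × Space d) × (Space d × ℕ) | z.2.1 = z.1.2}.indicator
        (fun z => (z.2.2 : ℝ≥0∞)) (p, q)) := by
    refine Measurable.indicator (by fun_prop) ?_
    exact measurableSet_eq_fun (by fun_prop) (by fun_prop)
  convert Measurable.lintegral_kernel_prod_right
    (κ := (markedKernel d).comap Prod.fst measurable_fst) hf using 1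
  ext ⟨c, x⟩
  simp only [Kernel.comap_apply, lintegral_markedKernel]
  by_cases hx : x ∈ c.points
  · rw [tsum_eq_single ⟨x, hx⟩]
    · simp
    · rintro ⟨y, hy⟩ hne
      exact indicator_of_notMem (show ((c, x), y, c.stubs y) ∉
        {z : (MarkedConfig d × Space d) × (Space d × ℕ) | z.2.1 = z.1.2} from
        fun h => hne (Subtype.ext h)) _
  · have h0 : c.stubs x = 0 := by simpa [MarkedConfig.points] using hx
    rw [h0, Nat.cast_zero, eq_comm, ENNReal.tsum_eq_zero]
    rintro ⟨y, hy⟩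
    refine indicator_of_notMem (show ((c, x), y, c.stubs y) ∉
      {z : (MarkedConfig d × Space d) × (Space d × ℕ) | z.2.1 = z.1.2} from fun h => ?_) _
    exact hx ((show y = x from h) ▸ hy)

theorem measurableSet_mem_points :
    MeasurableSet {p : MarkedConfig d × Space d | p.2 ∈ p.1.points} := by
  convert (measurable_stubs (d := d)) (measurableSet_singleton 0).compl using 1
  ext p
  simp [MarkedConfig.points]

end Measurability

/-! ### Measurability of the algorithm -/

/-- Pairs of a red and a blue configuration. -/
abbrev ConfigPair (d : ℕ) : Type := MarkedConfig d × MarkedConfig d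

section Rules

variable {E : MarkedConfig d → MarkedConfig d → EdgeSet d}

theorem redDegree_eq_lintegral {r b : MarkedConfig d} {M : EdgeSet d}
    (hM : M ⊆ r.points ×ˢ b.points) (x : Space d) :
    (redDegree M x : ℝ≥0∞) = ∫⁻ y, M.indicator 1 (x, y) ∂pointKernel d b := by
  have hsub : {y | (x, y) ∈ M} ⊆ b.points := fun y (hy : (x, y) ∈ M) => (hM hy).2
  have hrow : {y | (x, y) ∈ M} = {y | (x, y) ∈ M} ∩ b.points := (inter_eq_left.2 hsub).symm
  have hmeas : MeasurableSet {y | (x, y) ∈ M} := ((countable_points b).mono hsub).measurableSet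
  rw [pointKernel_apply, redDegree, hrow, ← Measure.count_apply
    (hmeas.inter (measurableSet_points b)), ← Measure.restrict_apply hmeas,
    ← lintegral_indicator_one hmeas]
  rfl

theorem blueDegree_eq_lintegral {r b : MarkedConfig d} {M : EdgeSet d}
    (hM : M ⊆ r.points ×ˢ b.points) (y : Space d) :
    (blueDegree M y : ℝ≥0∞) = ∫⁻ x, M.indicator 1 (x, y) ∂pointKernel d r :=
  redDegree_eq_lintegral (M := Prod.swap ⁻¹' M) (fun _ hp => ⟨(hM hp).2, (hM hp).1⟩) y

theorem measurable_indicator_edges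
    (hE : MeasurableSet {p : ConfigPair d × (Space d × Space d) | p.2 ∈ E p.1.1 p.1.2}) :
    Measurable fun p : ConfigPair d × (Space d × Space d) =>
      (E p.1.1 p.1.2).indicator (1 : Space d × Space d → ℝ≥0∞) p.2 :=
  (measurable_const (a := (1 : ℝ≥0∞))).indicator hE

theorem measurable_redDegree (hsub : ∀ r b, E r b ⊆ r.points ×ˢ b.points)
    (hE : MeasurableSet {p : ConfigPair d × (Space d × Space d) | p.2 ∈ E p.1.1 p.1.2}) :
    Measurable fun p : ConfigPair d × Space d => (redDegree (E p.1.1 p.1.2) p.2 : ℝ≥0∞) := by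
  simp_rw [fun p : ConfigPair d × Space d => redDegree_eq_lintegral (hsub p.1.1 p.1.2) p.2]
  refine measurable_lintegral_pointKernel (g := fun p : ConfigPair d × Space d => p.1.2)
    (by fun_prop) ?_
  exact (measurable_indicator_edges hE).comp
    (f := fun q : (ConfigPair d × Space d) × Space d => (q.1.1, (q.1.2, q.2))) (by fun_prop)

theorem measurable_blueDegree (hsub : ∀ r b, E r b ⊆ r.points ×ˢ b.points)
    (hE : MeasurableSet {p : ConfigPair d × (Space d × Space d) | p.2 ∈ E p.1.1 p.1.2}) :
    Measurable fun p : ConfigPair d × Space d => (blueDegree (E p.1.1 p.1.2) p.2 : ℝ≥0∞) := by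
  simp_rw [fun p : ConfigPair d × Space d => blueDegree_eq_lintegral (hsub p.1.1 p.1.2) p.2]
  refine measurable_lintegral_pointKernel (g := fun p : ConfigPair d × Space d => p.1.1)
    (by fun_prop) ?_
  exact (measurable_indicator_edges hE).comp
    (f := fun q : (ConfigPair d × Space d) × Space d => (q.1.1, (q.2, q.1.2))) (by fun_prop)

theorem redDegree_lt_iff {M : EdgeSet d} {x : Space d} {k : ℕ} :
    redDegree M x < k ↔ (redDegree M x : ℝ≥0∞) < k := by
  rw [← ENat.toENNReal_coe, ENat.toENNReal_lt]

theorem blueDegree_lt_iff {M : EdgeSet d} {x : Space d} {k : ℕ} :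
    blueDegree M x < k ↔ (blueDegree M x : ℝ≥0∞) < k := by
  rw [← ENat.toENNReal_coe, ENat.toENNReal_lt]

theorem measurableSet_compatible (hsub : ∀ r b, E r b ⊆ r.points ×ˢ b.points)
    (hE : MeasurableSet {p : ConfigPair d × (Space d × Space d) | p.2 ∈ E p.1.1 p.1.2}) :
    MeasurableSet {p : ConfigPair d × (Space d × Space d) |
      Compatible p.1.1 p.1.2 (E p.1.1 p.1.2) p.2.1 p.2.2} := by
  simp only [Compatible, redDegree_lt_iff, blueDegree_lt_iff]
  refine MeasurableSet.inter ?_ (MeasurableSet.inter ?_ (MeasurableSet.inter ?_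
    (MeasurableSet.inter ?_ hE.compl)))
  · exact measurableSet_mem_points.preimage
      (f := fun p : ConfigPair d × (Space d × Space d) => (p.1.1, p.2.1)) (by fun_prop)
  · exact measurableSet_mem_points.preimage
      (f := fun p : ConfigPair d × (Space d × Space d) => (p.1.2, p.2.2)) (by fun_prop)
  · exact measurableSet_lt ((measurable_redDegree hsub hE).comp
      (f := fun p : ConfigPair d × (Space d × Space d) => (p.1, p.2.1)) (by fun_prop))
      (measurable_stubs.comp
        (f := fun p : ConfigPair d × (Space d × Space d) => (p.1.1, p.2.1)) (by fun_prop))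
  · exact measurableSet_lt ((measurable_blueDegree hsub hE).comp
      (f := fun p : ConfigPair d × (Space d × Space d) => (p.1, p.2.2)) (by fun_prop))
      (measurable_stubs.comp
        (f := fun p : ConfigPair d × (Space d × Space d) => (p.1.2, p.2.2)) (by fun_prop))

theorem mutuallyClosest_iff {r b : MarkedConfig d} {M : EdgeSet d} {x y : Space d} :
    MutuallyClosest r b M x y ↔ Compatible r b M x y ∧
      (∀ y' ∈ b.points, Compatible r b M x y' → y' ≠ y → dist x y < dist x y') ∧
      (∀ x' ∈ r.points, Compatible r b M x' y → x' ≠ x → dist x y < dist x' y) :=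
  ⟨fun h => ⟨h.1, fun y' _ => h.2.1 y', fun x' _ => h.2.2 x'⟩,
    fun h => ⟨h.1, fun y' hy' => h.2.1 y' hy'.2.1 hy', fun x' hx' => h.2.2 x' hx'.1 hx'⟩⟩

theorem measurableSet_mutuallyClosest (hsub : ∀ r b, E r b ⊆ r.points ×ˢ b.points)
    (hE : MeasurableSet {p : ConfigPair d × (Space d × Space d) | p.2 ∈ E p.1.1 p.1.2}) :
    MeasurableSet {p : ConfigPair d × (Space d × Space d) |
      MutuallyClosest p.1.1 p.1.2 (E p.1.1 p.1.2) p.2.1 p.2.2} := by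
  have hc := measurableSet_compatible hsub hE
  simp only [mutuallyClosest_iff]
  refine hc.inter (MeasurableSet.inter ?_ ?_)
  · refine measurableSet_forall_mem_points
      (g := fun p : ConfigPair d × (Space d × Space d) => p.1.2) (by fun_prop)
      (p := fun p y' => Compatible p.1.1 p.1.2 (E p.1.1 p.1.2) p.2.1 y' → y' ≠ p.2.2 →
        dist p.2.1 p.2.2 < dist p.2.1 y') ?_
    refine MeasurableSet.imp (hc.preimage (f := fun q : (ConfigPair d × (Space d × Space d)) ×
      Space d => (q.1.1, (q.1.2.1, q.2))) (by fun_prop)) (MeasurableSet.imp ?_ ?_)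
    · exact (measurableSet_eq_fun (by fun_prop) (by fun_prop)).compl
    · exact measurableSet_lt (by fun_prop) (by fun_prop)
  · refine measurableSet_forall_mem_points
      (g := fun p : ConfigPair d × (Space d × Space d) => p.1.1) (by fun_prop)
      (p := fun p x' => Compatible p.1.1 p.1.2 (E p.1.1 p.1.2) x' p.2.2 → x' ≠ p.2.1 →
        dist p.2.1 p.2.2 < dist x' p.2.2) ?_
    refine MeasurableSet.imp (hc.preimage (f := fun q : (ConfigPair d × (Space d × Space d)) ×
      Space d => (q.1.1, (q.2, q.1.2.2))) (by fun_prop)) (MeasurableSet.imp ?_ ?_)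
    · exact (measurableSet_eq_fun (by fun_prop) (by fun_prop)).compl
    · exact measurableSet_lt (by fun_prop) (by fun_prop)

end Rules

theorem measurableSet_cimcStep (n : ℕ) : MeasurableSet
    {p : ConfigPair d × (Space d × Space d) | p.2 ∈ cimcStep p.1.1 p.1.2 n} := by
  induction n with
  | zero => exact MeasurableSet.empty
  | succ n ih =>
    exact ih.union (measurableSet_mutuallyClosest (E := fun r b => cimcStep r b n)
      (fun r b => cimcStep_subset r b n) ih)

theorem measurableSet_cimc : MeasurableSet
    {p : ConfigPair d × (Space d × Space d) | p.2 ∈ cimc p.1.1 p.1.2} := by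
  simp only [cimc, mem_iUnion, ofPred_exists]
  exact MeasurableSet.iUnion measurableSet_cimcStep

theorem edgeMeasure_apply {r b : MarkedConfig d} {M : EdgeSet d}
    (hM : M ⊆ r.points ×ˢ b.points) {A : Set (Space d × Space d)} (hA : MeasurableSet A) :
    edgeMeasure M A =
      ∫⁻ x, ∫⁻ y, (M ∩ A).indicator 1 (x, y) ∂pointKernel d b ∂pointKernel d r := by
  have hprod : (r.points ×ˢ b.points).Countable :=
    (countable_points r).prod (countable_points b)
  have hmeas : MeasurableSet M := (hprod.mono hM).measurableSet
  have hk : (M ∩ A) = (M ∩ A) ∩ r.points ×ˢ b.points :=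
    (inter_eq_left.2 (inter_subset_left.trans hM)).symm
  rw [edgeMeasure, Measure.restrict_apply hA, inter_comm, hk, ← Measure.restrict_apply
    (hmeas.inter hA), ← lintegral_indicator_one (hmeas.inter hA), lintegral_countable _ hprod,
    lintegral_pointKernel]
  simp_rw [lintegral_pointKernel]
  rw [← ENNReal.tsum_prod, ← (Equiv.Set.prod r.points b.points).tsum_eq]
  refine tsum_congr fun p => ?_
  rw [← hk, Measure.count_singleton, mul_one]
  rfl

theorem measurable_edgeMeasure_cimc :
    Measurable fun c : ConfigPair d => edgeMeasure (cimc c.1 c.2) := by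
  refine Measure.measurable_of_measurable_coe _ fun A hA => ?_
  simp_rw [fun c : ConfigPair d => edgeMeasure_apply (cimc_subset c.1 c.2) hA]
  refine measurable_lintegral_pointKernel measurable_fst ?_
  refine measurable_lintegral_pointKernel (g := fun p : ConfigPair d × Space d => p.1.2)
    (by fun_prop) ?_
  refine (measurable_indicator_edges (E := fun r b => cimc r b ∩ A)
    (measurableSet_cimc.inter (measurable_snd hA))).comp
    (f := fun q : (ConfigPair d × Space d) × Space d => (q.1.1, (q.1.2, q.2))) (by fun_prop)

theorem measurable_redDegree_cimc : Measurable fun p : ConfigPair d × Space d =>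
    (redDegree (cimc p.1.1 p.1.2) p.2 : ℝ≥0∞) :=
  measurable_redDegree cimc_subset measurableSet_cimc

theorem measurableSet_unmatched :
    MeasurableSet {p : ConfigPair d × Space d | p.2 ∈ unmatched p.1.1 p.1.2} := by
  simp only [unmatched, mem_ofPred_eq, redDegree_lt_iff]
  exact measurableSet_lt measurable_redDegree_cimc (measurable_stubs.comp
    (f := fun p : ConfigPair d × Space d => (p.1.1, p.2)) (by fun_prop))

/-! ### Translations -/

@[simp] theorem stubs_vadd (v : Space d) (c : MarkedConfig d) (x : Space d) :
    (v +ᵥ c).stubs x = c.stubs (x - v) := rfl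

theorem mem_points_vadd {v : Space d} {c : MarkedConfig d} {x : Space d} :
    x ∈ (v +ᵥ c).points ↔ x - v ∈ c.points := Iff.rfl

theorem mem_translateEdges {v : Space d} {M : EdgeSet d} {x y : Space d} :
    (x, y) ∈ translateEdges v M ↔ (x - v, y - v) ∈ M := by
  constructor
  · rintro ⟨⟨x', y'⟩, h, heq⟩
    obtain ⟨rfl, rfl⟩ := Prod.ext_iff.1 heq
    simpa using h
  · intro h
    exact ⟨_, h, by simp⟩

theorem redDegree_translateEdges (v : Space d) (M : EdgeSet d) (x : Space d) :
    redDegree (translateEdges v M) x = redDegree M (x - v) := by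
  have h : {y | (x, y) ∈ translateEdges v M} = (v + ·) '' {y | (x - v, y) ∈ M} := by
    ext y
    simp only [mem_translateEdges, mem_ofPred_eq, image_add_left, mem_preimage,
      neg_add_eq_sub]
  rw [redDegree, h, (add_right_injective v).encard_image, redDegree]

theorem translateEdges_swap (v : Space d) (M : EdgeSet d) :
    translateEdges v (Prod.swap ⁻¹' M) = Prod.swap ⁻¹' translateEdges v M := by
  ext ⟨x, y⟩
  simp only [mem_translateEdges, mem_preimage, Prod.swap_prod_mk]

theorem blueDegree_translateEdges (v : Space d) (M : EdgeSet d) (y : Space d) :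
    blueDegree (translateEdges v M) y = blueDegree M (y - v) := by
  have := redDegree_translateEdges v (Prod.swap ⁻¹' M) y
  rwa [translateEdges_swap] at this

theorem compatible_translateEdges {v : Space d} {r b : MarkedConfig d} {M : EdgeSet d}
    {x y : Space d} : Compatible (v +ᵥ r) (v +ᵥ b) (translateEdges v M) x y ↔
      Compatible r b M (x - v) (y - v) := by
  simp only [Compatible, mem_points_vadd, redDegree_translateEdges, blueDegree_translateEdges,
    stubs_vadd, mem_translateEdges]

theorem mutuallyClosest_translateEdges {v : Space d} {r b : MarkedConfig d} {M : EdgeSet d}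
    {x y : Space d} : MutuallyClosest (v +ᵥ r) (v +ᵥ b) (translateEdges v M) x y ↔
      MutuallyClosest r b M (x - v) (y - v) := by
  simp only [MutuallyClosest, compatible_translateEdges]
  refine and_congr_right fun _ => and_congr ?_ ?_
  · rw [← (Equiv.subRight v).forall_congr_right (q := fun z => Compatible r b M (x - v) z →
      z ≠ y - v → dist (x - v) (y - v) < dist (x - v) z)]
    simp
  · rw [← (Equiv.subRight v).forall_congr_right (q := fun z => Compatible r b M z (y - v) →
      z ≠ x - v → dist (x - v) (y - v) < dist z (y - v))]
    simp

theorem cimcStep_vadd (v : Space d) (r b : MarkedConfig d) (n : ℕ) :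
    cimcStep (v +ᵥ r) (v +ᵥ b) n = translateEdges v (cimcStep r b n) := by
  induction n with
  | zero => simp [cimcStep, translateEdges]
  | succ n ih =>
    ext ⟨x, y⟩
    rw [mem_translateEdges]
    simp only [cimcStep, ih, mem_union, mem_translateEdges, mem_ofPred_eq,
      mutuallyClosest_translateEdges]

theorem cimc_vadd (v : Space d) (r b : MarkedConfig d) :
    cimc (v +ᵥ r) (v +ᵥ b) = translateEdges v (cimc r b) := by
  simp only [cimc, cimcStep_vadd]
  exact (image_iUnion).symm

theorem mem_unmatched_vadd {v : Space d} {r b : MarkedConfig d} {x : Space d} :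
    x ∈ unmatched (v +ᵥ r) (v +ᵥ b) ↔ x - v ∈ unmatched r b := by
  simp only [unmatched, mem_ofPred_eq, cimc_vadd, redDegree_translateEdges, stubs_vadd]

theorem lintegral_pointKernel_vadd (v : Space d) (c : MarkedConfig d) (f : Space d → ℝ≥0∞) :
    ∫⁻ x, f x ∂pointKernel d (v +ᵥ c) = ∫⁻ x, f (v + x) ∂pointKernel d c := by
  rw [lintegral_pointKernel, lintegral_pointKernel]
  let e : c.points ≃ (v +ᵥ c).points := (Equiv.addLeft v).subtypeEquiv fun x => by
    simp [mem_points_vadd]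
  rw [← e.tsum_eq]
  rfl

instance : MeasurableConstVAdd (Space d) (MarkedConfig d) where
  measurable_const_vadd v := by
    rw [measurable_comap_iff]
    have hshift : Measurable fun p : Space d × ℕ => (v + p.1, p.2) := by fun_prop
    suffices h : MarkedConfig.toMeasure ∘ (fun c : MarkedConfig d => v +ᵥ c) =
        Measure.map (fun p : Space d × ℕ => (v + p.1, p.2)) ∘ MarkedConfig.toMeasure by
      rw [h]
      exact (Measure.measurable_map _ hshift).comp (comap_measurable _)
    refine funext fun c => Measure.ext fun A hA => ?_
    change markedKernel d (v +ᵥ c) A = (markedKernel d c).map _ A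
    rw [Measure.map_apply hshift hA, ← lintegral_indicator_one hA,
      ← lintegral_indicator_one (hshift hA), lintegral_markedKernel, lintegral_markedKernel]
    let e : c.points ≃ (v +ᵥ c).points := (Equiv.addLeft v).subtypeEquiv fun x => by
      simp [mem_points_vadd]
    rw [← e.tsum_eq]
    refine tsum_congr fun x => ?_
    change A.indicator 1 (v + (x : Space d), c.stubs (v + x - v)) = _
    rw [add_sub_cancel_left]
    rfl

theorem measurePreserving_vadd_pair (v : Space d) (Q : Measure (ConfigPair d))
    [VAddInvariantMeasure (Space d) (ConfigPair d) Q] :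
    MeasurePreserving (fun c : ConfigPair d => v +ᵥ c) Q Q := by
  refine ⟨?_, ?_⟩
  · exact ((measurable_const_vadd v).comp measurable_fst).prodMk
      ((measurable_const_vadd v).comp measurable_snd)
  · have hm : Measurable fun c : ConfigPair d => v +ᵥ c :=
      ((measurable_const_vadd v).comp measurable_fst).prodMk
        ((measurable_const_vadd v).comp measurable_snd)
    ext A hA
    rw [Measure.map_apply hm hA]
    exact VAddInvariantMeasure.measure_preimage_vadd v hA

/-! ### Mass transport -/

/-- The mass transport principle: the expected mass sent by the red points in a set of volume one
equals the expected mass received by the blue points in this set. Both sides equal the integral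
over `v` of the expected mass sent from red points in `W` to blue points in `v + W`. -/
theorem lintegral_mass_transport (Q : Measure (ConfigPair d)) [SFinite Q]
    [VAddInvariantMeasure (Space d) (ConfigPair d) Q]
    {F : ConfigPair d → Space d → Space d → ℝ≥0∞}
    (hF : Measurable fun p : ConfigPair d × (Space d × Space d) => F p.1 p.2.1 p.2.2)
    (hinv : ∀ v c x y, F (v +ᵥ c) (v + x) (v + y) = F c x y)
    {W : Set (Space d)} (hW : MeasurableSet W) (hvol : volume W = 1) :
    ∫⁻ c, ∫⁻ x in W, ∫⁻ y, F c x y ∂pointKernel d c.2 ∂pointKernel d c.1 ∂Q =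
      ∫⁻ c, ∫⁻ y in W, ∫⁻ x, F c x y ∂pointKernel d c.1 ∂pointKernel d c.2 ∂Q := by
  let w : Space d → ℝ≥0∞ := W.indicator 1
  have hw : Measurable w := measurable_one.indicator hW
  let m : ConfigPair d → Space d → ℝ≥0∞ := fun c v =>
    ∫⁻ x, ∫⁻ y, F c x y * (w x * w (y - v)) ∂pointKernel d c.2 ∂pointKernel d c.1
  let m' : ConfigPair d → Space d → ℝ≥0∞ := fun c v =>
    ∫⁻ x, ∫⁻ y, F c x y * (w (v + x) * w y) ∂pointKernel d c.2 ∂pointKernel d c.1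
  have hFm : Measurable fun q : ((ConfigPair d × Space d) × Space d) × Space d =>
      F q.1.1.1 q.1.2 q.2 :=
    hF.comp (f := fun q : ((ConfigPair d × Space d) × Space d) × Space d =>
      (q.1.1.1, (q.1.2, q.2))) (by fun_prop)
  have hm : Measurable (Function.uncurry m) := by
    refine measurable_lintegral_pointKernel (g := fun p : ConfigPair d × Space d => p.1.1)
      (by fun_prop) ?_
    refine measurable_lintegral_pointKernel
      (g := fun p : (ConfigPair d × Space d) × Space d => p.1.1.2) (by fun_prop) ?_
    refine hFm.mul ((hw.comp ?_).mul (hw.comp ?_)) <;> fun_prop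
  have hm' : Measurable (Function.uncurry m') := by
    refine measurable_lintegral_pointKernel (g := fun p : ConfigPair d × Space d => p.1.1)
      (by fun_prop) ?_
    refine measurable_lintegral_pointKernel
      (g := fun p : (ConfigPair d × Space d) × Space d => p.1.1.2) (by fun_prop) ?_
    refine hFm.mul ((hw.comp ?_).mul (hw.comp ?_)) <;> fun_prop
  have hshift : ∀ c v, m (v +ᵥ c) v = m' c v := by
    intro c v
    change ∫⁻ x, ∫⁻ y, _ ∂pointKernel d (v +ᵥ c.2) ∂pointKernel d (v +ᵥ c.1) = _
    rw [lintegral_pointKernel_vadd]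
    simp only [lintegral_pointKernel_vadd, hinv, add_sub_cancel_left, m']
  have hvolR : ∀ y, ∫⁻ v, w (y - v) = 1 := by
    intro y
    rw [lintegral_sub_left_eq_self w y, lintegral_indicator_one hW, hvol]
  have hvolL : ∀ x, ∫⁻ v, w (v + x) = 1 := by
    intro x
    rw [lintegral_add_right_eq_self w x, lintegral_indicator_one hW, hvol]
  have hFc : ∀ c, Measurable fun q : (Space d × Space d) × Space d => F c q.1.2 q.2 := fun c =>
    hF.comp (f := fun q : (Space d × Space d) × Space d => (c, (q.1.2, q.2))) (by fun_prop)
  have hFc' : ∀ c x, Measurable fun q : Space d × Space d => F c x q.2 := fun c x =>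
    hF.comp (f := fun q : Space d × Space d => (c, (x, q.2))) (by fun_prop)
  -- integrating out `v` with Tonelli
  have hout : ∀ c, ∫⁻ v, m c v =
      ∫⁻ x in W, ∫⁻ y, F c x y ∂pointKernel d c.2 ∂pointKernel d c.1 := by
    intro c
    rw [← lintegral_indicator hW]
    have h1 : Measurable (Function.uncurry fun v x =>
        ∫⁻ y, F c x y * (w x * w (y - v)) ∂pointKernel d c.2) := by
      refine measurable_lintegral_pointKernel (g := fun _ : Space d × Space d => c.2)
        measurable_const ?_
      refine (hFc c).mul ((hw.comp ?_).mul (hw.comp ?_)) <;> fun_prop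
    rw [lintegral_lintegral_swap h1.aemeasurable]
    refine lintegral_congr fun x => ?_
    rw [lintegral_lintegral_swap]
    · have : ∀ y, ∫⁻ v, F c x y * (w x * w (y - v)) = w x * F c x y := by
        intro y
        rw [lintegral_const_mul _ (by fun_prop), lintegral_const_mul _ (by fun_prop), hvolR,
          mul_one, mul_comm]
      simp_rw [this]
      by_cases hx : x ∈ W <;> simp [w, hx]
    · refine Measurable.aemeasurable ?_
      refine (hFc' c x).mul (measurable_const.mul (hw.comp ?_))
      fun_prop
  have hin : ∀ c, ∫⁻ v, m' c v =
      ∫⁻ y in W, ∫⁻ x, F c x y ∂pointKernel d c.1 ∂pointKernel d c.2 := by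
    intro c
    have h1 : Measurable (Function.uncurry fun v x =>
        ∫⁻ y, F c x y * (w (v + x) * w y) ∂pointKernel d c.2) := by
      refine measurable_lintegral_pointKernel (g := fun _ : Space d × Space d => c.2)
        measurable_const ?_
      refine (hFc c).mul ((hw.comp ?_).mul (hw.comp ?_)) <;> fun_prop
    rw [lintegral_lintegral_swap h1.aemeasurable, ← lintegral_indicator hW]
    have h2 : ∀ x, ∫⁻ v, ∫⁻ y, F c x y * (w (v + x) * w y) ∂pointKernel d c.2 =
        ∫⁻ y, w y * F c x y ∂pointKernel d c.2 := by
      intro x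
      rw [lintegral_lintegral_swap]
      · refine lintegral_congr fun y => ?_
        rw [lintegral_const_mul _ (by fun_prop), lintegral_mul_const _ (by fun_prop), hvolL,
          one_mul, mul_comm]
      · refine Measurable.aemeasurable ?_
        refine (hFc' c x).mul ((hw.comp ?_).mul (hw.comp ?_)) <;> fun_prop
    simp_rw [h2]
    have hFcc : Measurable fun p : Space d × Space d => F c p.1 p.2 :=
      hF.comp (f := fun p : Space d × Space d => (c, p)) (by fun_prop)
    rw [lintegral_lintegral_swap]
    · refine lintegral_congr fun y => ?_
      by_cases hy : y ∈ W <;> simp [w, hy]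
    · exact ((hw.comp measurable_snd).mul hFcc).aemeasurable
  simp_rw [← hout, ← hin]
  rw [lintegral_lintegral_swap hm.aemeasurable, lintegral_lintegral_swap hm'.aemeasurable]
  refine lintegral_congr fun v => ?_
  rw [← (measurePreserving_vadd_pair v Q).lintegral_comp (f := fun c => m c v)
    (hm.comp (measurable_id.prodMk measurable_const))]
  simp only [hshift]

theorem lintegral_redDegree_eq_lintegral_blueDegree (Q : Measure (ConfigPair d)) [SFinite Q]
    [VAddInvariantMeasure (Space d) (ConfigPair d) Q]
    {W : Set (Space d)} (hW : MeasurableSet W) (hvol : volume W = 1) :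
    ∫⁻ c, ∫⁻ x in W, redDegree (cimc c.1 c.2) x ∂pointKernel d c.1 ∂Q =
      ∫⁻ c, ∫⁻ y in W, redDegree (cimc c.2 c.1) y ∂pointKernel d c.2 ∂Q := by
  have h := lintegral_mass_transport Q
    (F := fun c x y => (cimc c.1 c.2).indicator 1 (x, y))
    (measurable_indicator_edges measurableSet_cimc) ?_ hW hvol
  · have hred : ∀ c : ConfigPair d,
        ∫⁻ x in W, redDegree (cimc c.1 c.2) x ∂pointKernel d c.1 =
          ∫⁻ x in W, ∫⁻ y, (cimc c.1 c.2).indicator 1 (x, y) ∂pointKernel d c.2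
            ∂pointKernel d c.1 := fun c =>
      lintegral_congr fun x => redDegree_eq_lintegral (cimc_subset c.1 c.2) x
    have hblue : ∀ c : ConfigPair d,
        ∫⁻ y in W, redDegree (cimc c.2 c.1) y ∂pointKernel d c.2 =
          ∫⁻ y in W, ∫⁻ x, (cimc c.1 c.2).indicator 1 (x, y) ∂pointKernel d c.1
            ∂pointKernel d c.2 := fun c =>
      lintegral_congr fun y => by
        rw [← blueDegree_cimc]
        exact blueDegree_eq_lintegral (cimc_subset c.1 c.2) y
    rw [lintegral_congr hred, lintegral_congr hblue]
    exact h
  · intro v c x y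
    have : (v + x, v + y) ∈ cimc (v +ᵥ c).1 (v +ᵥ c).2 ↔ (x, y) ∈ cimc c.1 c.2 := by
      change (v + x, v + y) ∈ cimc (v +ᵥ c.1) (v +ᵥ c.2) ↔ _
      rw [cimc_vadd, mem_translateEdges, add_sub_cancel_left, add_sub_cancel_left]
    by_cases hxy : (x, y) ∈ cimc c.1 c.2
    · rw [indicator_of_mem hxy, indicator_of_mem (this.2 hxy)]; rfl
    · rw [indicator_of_notMem hxy, indicator_of_notMem (mt this.1 hxy)]

/-! ### Unmatched points under an invariant law -/

theorem measurableSet_unmatched_subset {W : Set (Space d)} (hW : MeasurableSet W) :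
    MeasurableSet {c : ConfigPair d | unmatched c.1 c.2 ⊆ W} := by
  have : {c : ConfigPair d | unmatched c.1 c.2 ⊆ W} =
      {c | ∀ x ∈ c.1.points, x ∈ unmatched c.1 c.2 → x ∈ W} := by
    ext c
    exact ⟨fun h x _ hx => h hx, fun h x hx => h x (unmatched_subset _ _ hx) hx⟩
  rw [this]
  exact measurableSet_forall_mem_points measurable_fst
    (measurableSet_unmatched.imp (measurable_snd hW))

theorem measurableSet_unmatched_nonempty :
    MeasurableSet {c : ConfigPair d | (unmatched c.1 c.2).Nonempty} := by
  convert (measurableSet_unmatched_subset (d := d) MeasurableSet.empty).compl using 1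
  ext c
  simp [nonempty_iff_ne_empty, subset_empty_iff]

/-- A stationary process of unmatched points is almost surely empty or infinite, since a
nonempty bounded set cannot recur under the iterates of a large translation. -/
theorem ae_unmatched_empty_or_infinite (hd : 1 ≤ d) (Q : Measure (ConfigPair d))
    [IsFiniteMeasure Q] [VAddInvariantMeasure (Space d) (ConfigPair d) Q] :
    ∀ᵐ c ∂Q, unmatched c.1 c.2 = ∅ ∨ (unmatched c.1 c.2).Infinite := by
  set A : ℕ → Set (ConfigPair d) := fun n =>
    {c | (unmatched c.1 c.2).Nonempty ∧ unmatched c.1 c.2 ⊆ Metric.closedBall 0 n} with hA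
  have hAm : ∀ n, MeasurableSet (A n) := fun n =>
    measurableSet_unmatched_nonempty.inter
      (measurableSet_unmatched_subset measurableSet_closedBall)
  have hnull : ∀ n, Q (A n) = 0 := by
    intro n
    by_contra hpos
    let e : Space d := EuclideanSpace.single ⟨0, hd⟩ 1
    have he : ‖e‖ = 1 := by simp [e]
    set v : Space d := (2 * n + 1 : ℝ) • e
    obtain ⟨c, hc, m, hm, hmc⟩ := (measurePreserving_vadd_pair v Q).exists_mem_iterate_mem
      (hAm n).nullMeasurableSet hpos
    have hiter : ∀ k : ℕ, (fun c : ConfigPair d => v +ᵥ c)^[k] c = (k • v) +ᵥ c := by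
      intro k
      induction k with
      | zero => simp
      | succ k ih => rw [Function.iterate_succ_apply', ih, ← add_vadd, succ_nsmul', add_comm]
    rw [hiter] at hmc
    obtain ⟨x, hx⟩ := hc.1
    have hx1 := mem_closedBall_zero_iff.1 (hc.2 hx)
    have hx2 : m • v + x ∈ unmatched (m • v +ᵥ c).1 (m • v +ᵥ c).2 := by
      refine mem_unmatched_vadd.2 ?_
      rwa [add_sub_cancel_left]
    have hx3 := mem_closedBall_zero_iff.1 (hmc.2 hx2)
    have hnorm : ‖m • v‖ = m * (2 * n + 1) := by
      rw [← Nat.cast_smul_eq_nsmul ℝ, norm_smul, norm_smul, he, mul_one, Real.norm_natCast,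
        Real.norm_of_nonneg (by positivity)]
    have hm1 : (1 : ℝ) ≤ m := by exact_mod_cast Nat.one_le_iff_ne_zero.2 hm
    have htri : ‖m • v‖ ≤ ‖m • v + x‖ + ‖x‖ := by
      simpa using norm_sub_le (m • v + x) x
    have hn0 : (0 : ℝ) ≤ n := Nat.cast_nonneg n
    nlinarith
  filter_upwards [ae_all_iff.2 fun n => measure_eq_zero_iff_ae_notMem.1 (hnull n)] with c hc
  by_contra! hcon
  obtain ⟨hne, hfin⟩ := hcon
  obtain ⟨ρ, hρ⟩ := hfin.isBounded.subset_closedBall 0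
  obtain ⟨n, hn⟩ := exists_nat_ge ρ
  exact hc n ⟨hne, hρ.trans (Metric.closedBall_subset_closedBall hn)⟩

theorem ae_unmatched_const (Q : Measure (ConfigPair d))
    [ErgodicVAdd (Space d) (ConfigPair d) Q] :
    (∀ᵐ c ∂Q, (unmatched c.1 c.2).Nonempty) ∨ ∀ᵐ c ∂Q, unmatched c.1 c.2 = ∅ := by
  have h := ErgodicVAdd.aeconst_of_forall_preimage_vadd_ae_eq (G := Space d) (μ := Q)
    (measurableSet_unmatched_nonempty (d := d)) fun v => by
      refine Filter.Eventually.of_forall fun c => propext ?_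
      change (unmatched (v +ᵥ c.1) (v +ᵥ c.2)).Nonempty ↔ (unmatched c.1 c.2).Nonempty
      constructor
      · rintro ⟨x, hx⟩
        exact ⟨_, mem_unmatched_vadd.1 hx⟩
      · rintro ⟨x, hx⟩
        exact ⟨v + x, mem_unmatched_vadd.2 (by rwa [add_sub_cancel_left])⟩
  rw [Filter.eventuallyConst_set] at h
  refine h.imp id fun h => ?_
  filter_upwards [h] with c hc
  exact not_nonempty_iff_eq_empty.1 hc

/-- If almost surely the points in one ball have no unmatched stubs, then no point has: the
translates of the ball cover the space. -/
theorem ae_unmatched_eq_empty_of_ball (Q : Measure (ConfigPair d))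
    [VAddInvariantMeasure (Space d) (ConfigPair d) Q] {ρ : ℝ} (hρ : 0 < ρ)
    (h : ∀ᵐ c ∂Q, unmatched c.1 c.2 ⊆ (Metric.ball 0 ρ)ᶜ) :
    ∀ᵐ c ∂Q, unmatched c.1 c.2 = ∅ := by
  have hall : ∀ n : ℕ, ∀ᵐ c : ConfigPair d ∂Q,
      unmatched (-TopologicalSpace.denseSeq (Space d) n +ᵥ c.1)
        (-TopologicalSpace.denseSeq (Space d) n +ᵥ c.2) ⊆ (Metric.ball 0 ρ)ᶜ := fun n =>
    (measurePreserving_vadd_pair (-TopologicalSpace.denseSeq (Space d) n) Q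
      ).quasiMeasurePreserving.ae h
  filter_upwards [ae_all_iff.2 hall] with c hc
  refine eq_empty_of_forall_notMem fun x hx => ?_
  obtain ⟨n, hn⟩ := (TopologicalSpace.denseRange_denseSeq (Space d)).exists_dist_lt x hρ
  refine hc n (a := x - TopologicalSpace.denseSeq (Space d) n) ?_ ?_
  · rw [mem_unmatched_vadd]
    simpa using hx
  · rwa [mem_ball_zero_iff, ← dist_eq_norm]

/-! ### Stub intensities -/

theorem setLIntegral_pointKernel_eq_sum {c : MarkedConfig d} {W : Set (Space d)}
    (hW : MeasurableSet W) {f : Space d → ℝ≥0∞} {s : Finset (Space d)} (hsW : ∀ x ∈ s, x ∈ W)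
    (hs : ∀ x ∈ c.points ∩ W, x ∈ s) (hf : ∀ x ∉ c.points, f x = 0) :
    ∫⁻ x in W, f x ∂pointKernel d c = ∑ x ∈ s, f x := by
  rw [← lintegral_indicator hW, lintegral_pointKernel, tsum_subtype c.points (W.indicator f),
    tsum_eq_sum (s := s)]
  · refine Finset.sum_congr rfl fun x hx => ?_
    by_cases hxc : x ∈ c.points
    · rw [indicator_of_mem hxc, indicator_of_mem (hsW x hx)]
    · rw [indicator_of_notMem hxc, hf x hxc]
  · intro x hx
    by_cases hxc : x ∈ c.points
    · rw [indicator_of_mem hxc, indicator_of_notMem fun hxW => hx (hs x ⟨hxc, hxW⟩)]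
    · rw [indicator_of_notMem hxc]

/-- The number of stubs of the points in `W`. -/
noncomputable def stubCount (W : Set (Space d)) (c : MarkedConfig d) : ℝ≥0∞ :=
  ∫⁻ x in W, c.stubs x ∂pointKernel d c

theorem stubCount_eq_sum {c : MarkedConfig d} {W : Set (Space d)} (hW : MeasurableSet W)
    {s : Finset (Space d)} (hsW : ∀ x ∈ s, x ∈ W) (hs : ∀ x ∈ c.points ∩ W, x ∈ s) :
    stubCount W c = ∑ x ∈ s, (c.stubs x : ℝ≥0∞) :=
  setLIntegral_pointKernel_eq_sum hW hsW hs fun x hx => by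
    simpa [MarkedConfig.points] using hx

theorem measurable_setLIntegral_pointKernel {α : Type*} [MeasurableSpace α]
    {g : α → MarkedConfig d} (hg : Measurable g) {f : α → Space d → ℝ≥0∞}
    (hf : Measurable (Function.uncurry f)) {W : Set (Space d)} (hW : MeasurableSet W) :
    Measurable fun a => ∫⁻ x in W, f a x ∂pointKernel d (g a) := by
  simp_rw [← lintegral_indicator hW]
  exact measurable_lintegral_pointKernel hg (hf.indicator (measurable_snd hW))

theorem measurable_stubCount {W : Set (Space d)} (hW : MeasurableSet W) :
    Measurable (stubCount W) :=
  measurable_setLIntegral_pointKernel measurable_id measurable_stubs hW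

theorem stubs_remark_of_mem {c : MarkedConfig d} (f : c.points → ℕ) {x : Space d}
    (hx : x ∈ c.points) : (c.remark f).stubs x = f ⟨x, hx⟩ := dif_pos hx

theorem points_remark_subset (c : MarkedConfig d) (f : c.points → ℕ) :
    (c.remark f).points ⊆ c.points := by
  intro x hx
  by_contra h
  exact hx (dif_neg h)

/-- The layer-cake formula for a quantity with natural values. -/
theorem tsum_indicator_lt_natCast (k : ℕ) :
    ∑' n : ℕ, (if (n : ℝ≥0∞) < k then (1 : ℝ≥0∞) else 0) = k := by
  rw [tsum_eq_sum (s := Finset.range k)]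
  · rw [Finset.sum_congr rfl fun n hn => if_pos (Nat.cast_lt.2 (Finset.mem_range.1 hn))]
    simp
  · intro n hn
    rw [if_neg]
    simpa using hn

theorem lintegral_eq_tsum_measure_lt {α : Type*} [MeasurableSpace α] (m : Measure α)
    {N : α → ℝ≥0∞} (hN : Measurable N) (hnat : ∀ a, ∃ k : ℕ, N a = k) :
    ∫⁻ a, N a ∂m = ∑' n : ℕ, m {a | (n : ℝ≥0∞) < N a} := by
  have hset : ∀ n : ℕ, MeasurableSet {a | (n : ℝ≥0∞) < N a} := fun n =>
    measurableSet_lt measurable_const hN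
  simp_rw [← fun n => lintegral_indicator_one (μ := m) (hset n)]
  rw [← lintegral_tsum fun n => (measurable_one.indicator (hset n)).aemeasurable]
  refine lintegral_congr fun a => ?_
  obtain ⟨k, hk⟩ := hnat a
  rw [hk, ← tsum_indicator_lt_natCast k]
  refine tsum_congr fun n => ?_
  simp [indicator, hk]

section Marks

variable {Ω : Type*} [MeasurableSpace Ω]

theorem groundSigma_le {R : Ω → MarkedConfig d} (hR : Measurable R) :
    groundSigma R ≤ ‹MeasurableSpace Ω› := by
  refine Measurable.comap_le ?_
  have : Measurable fun ω => pointKernel d (R ω) := (pointKernel d).measurable.comp hR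
  simpa only [pointKernel_apply] using this

theorem HasIIDMarks.aemeasurable_and_lintegral {P : Measure Ω} [IsProbabilityMeasure P]
    {R : Ω → MarkedConfig d} (hR : Measurable R) {ν : Measure ℕ} [IsProbabilityMeasure ν]
    (h : HasIIDMarks P R ν) {C : Set (MarkedConfig d)} (hC : MeasurableSet C) :
    AEMeasurable (fun ω => Measure.infinitePi (fun _ : (R ω).points => ν)
        {f | (R ω).remark f ∈ C}) P ∧
      ∫⁻ ω, Measure.infinitePi (fun _ : (R ω).points => ν) {f | (R ω).remark f ∈ C} ∂P =
        P (R ⁻¹' C) := by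
  have heq : (fun ω => Measure.infinitePi (fun _ : (R ω).points => ν) {f | (R ω).remark f ∈ C})
      =ᵐ[P] fun ω => ENNReal.ofReal
        ((P[(R ⁻¹' C).indicator (fun _ => (1 : ℝ)) | groundSigma R]) ω) := by
    filter_upwards [h C hC] with ω hω
    rw [hω, ofReal_measureReal]
  refine ⟨(integrable_condExp.aemeasurable.ennreal_ofReal).congr heq.symm, ?_⟩
  rw [lintegral_congr_ae heq, ← ofReal_integral_eq_lintegral_ofReal integrable_condExp,
    integral_condExp (groundSigma_le hR), integral_indicator_const _ (hR hC)]
  · simp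
  · refine condExp_nonneg (Filter.Eventually.of_forall fun ω => ?_)
    exact indicator_nonneg (fun _ _ => zero_le_one) ω

/-- With i.i.d. marks, the expected number of stubs in a bounded set is the expected number of
points times the mean mark. -/
theorem HasIIDMarks.lintegral_stubCount {P : Measure Ω} [IsProbabilityMeasure P]
    {R : Ω → MarkedConfig d} (hR : Measurable R) {ν : Measure ℕ} [IsProbabilityMeasure ν]
    (h : HasIIDMarks P R ν) {W : Set (Space d)} (hW : MeasurableSet W)
    (hWb : Bornology.IsBounded W) :
    ∫⁻ ω, stubCount W (R ω) ∂P =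
      (∫⁻ ω, (((R ω).points ∩ W).encard : ℝ≥0∞) ∂P) * mean ν := by
  have hnat : ∀ c : MarkedConfig d, ∃ k : ℕ, stubCount W c = k := by
    intro c
    refine ⟨∑ x ∈ (c.locallyFinite W hWb).toFinset, c.stubs x, ?_⟩
    rw [stubCount_eq_sum hW (s := (c.locallyFinite W hWb).toFinset)]
    · simp
    · intro x hx
      exact ((Finite.mem_toFinset _).1 hx).2
    · exact fun x hx => (Finite.mem_toFinset _).2 hx
  have hC : ∀ n : ℕ, MeasurableSet {c : MarkedConfig d | (n : ℝ≥0∞) < stubCount W c} := fun n =>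
    measurableSet_lt measurable_const (measurable_stubCount hW)
  have hremark : ∀ c : MarkedConfig d,
      ∫⁻ f, stubCount W (c.remark f) ∂Measure.infinitePi (fun _ : c.points => ν) =
        (c.points ∩ W).encard * mean ν ∧ Measurable fun f => stubCount W (c.remark f) := by
    intro c
    set s := (c.locallyFinite W hWb).toFinset with hs
    have hmem : ∀ x, x ∈ s ↔ x ∈ c.points ∩ W := fun x => Finite.mem_toFinset _
    have hsum : ∀ f : c.points → ℕ, stubCount W (c.remark f) =
        ∑ x : s, (f ⟨x, ((hmem x).1 x.2).1⟩ : ℝ≥0∞) := by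
      intro f
      rw [stubCount_eq_sum hW (s := s) (fun x hx => ((hmem x).1 hx).2)
        (fun x hx => (hmem x).2 ⟨points_remark_subset c f hx.1, hx.2⟩), ← Finset.sum_coe_sort]
      exact Finset.sum_congr rfl fun x _ => by
        rw [stubs_remark_of_mem f ((hmem x).1 x.2).1]
    have hmeas : ∀ x : s, Measurable fun f : c.points → ℕ =>
        (f ⟨x, ((hmem x).1 x.2).1⟩ : ℝ≥0∞) := fun x =>
      measurable_from_top.comp (measurable_pi_apply _)
    refine ⟨?_, ?_⟩
    · simp_rw [hsum]
      rw [lintegral_finsetSum _ fun x _ => hmeas x]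
      have hone : ∀ x : s, ∫⁻ f, (f ⟨x, ((hmem x).1 x.2).1⟩ : ℝ≥0∞)
          ∂Measure.infinitePi (fun _ : c.points => ν) = mean ν := fun x =>
        (measurePreserving_eval_infinitePi (fun _ : c.points => ν) _).lintegral_comp
          (f := fun k : ℕ => (k : ℝ≥0∞)) measurable_from_top
      have hcard : (c.points ∩ W).encard = (s.card : ℕ∞) := by
        rw [← encard_coe_eq_coe_finsetCard, hs, Finite.coe_toFinset]; rfl
      rw [Finset.sum_congr rfl fun x _ => hone x, hcard]
      simp
    · simp_rw [hsum]
      exact Finset.measurable_sum _ fun x _ => hmeas x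
  calc ∫⁻ ω, stubCount W (R ω) ∂P
      = ∑' n : ℕ, P (R ⁻¹' {c | (n : ℝ≥0∞) < stubCount W c}) :=
        lintegral_eq_tsum_measure_lt P ((measurable_stubCount hW).comp hR) fun ω => hnat (R ω)
    _ = ∑' n : ℕ, ∫⁻ ω, Measure.infinitePi (fun _ : (R ω).points => ν)
          {f | (R ω).remark f ∈ {c | (n : ℝ≥0∞) < stubCount W c}} ∂P :=
        tsum_congr fun n => (h.aemeasurable_and_lintegral hR (hC n)).2.symm
    _ = ∫⁻ ω, ∑' n : ℕ, Measure.infinitePi (fun _ : (R ω).points => ν)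
          {f | (R ω).remark f ∈ {c | (n : ℝ≥0∞) < stubCount W c}} ∂P :=
        (lintegral_tsum fun n => (h.aemeasurable_and_lintegral hR (hC n)).1).symm
    _ = ∫⁻ ω, ((R ω).points ∩ W).encard * mean ν ∂P := by
        refine lintegral_congr fun ω => ?_
        rw [← (hremark (R ω)).1, lintegral_eq_tsum_measure_lt _ (hremark (R ω)).2 fun f => hnat _]
        rfl
    _ = _ := by
        refine lintegral_mul_const _ ?_
        have : Measurable fun ω => pointKernel d (R ω) W :=
          ((pointKernel d).measurable_coe hW).comp hR
        convert this using 2 with ω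
        rw [pointKernel_apply, Measure.restrict_apply hW,
          Measure.count_apply (hW.inter (measurableSet_points _)), inter_comm]

end Marks

/-! ### Exhaustion of the stubs of one color -/

theorem ergodicVAdd_map_swap {Q : Measure (ConfigPair d)}
    (hQ : ErgodicVAdd (Space d) (ConfigPair d) Q) :
    ErgodicVAdd (Space d) (ConfigPair d) (Q.map Prod.swap) where
  measure_preimage_vadd v s hs := by
    have hs' := ((measurable_const_vadd v).comp measurable_fst).prodMk
        ((measurable_const_vadd v).comp measurable_snd) hs
    rw [Measure.map_apply measurable_swap hs]
    exact (Measure.map_apply measurable_swap hs').trans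
      (VAddInvariantMeasure.measure_preimage_vadd v (measurable_swap hs))
  aeconst_of_forall_preimage_vadd_ae_eq {s} hs hinv := by
    have h := hQ.aeconst_of_forall_preimage_vadd_ae_eq (measurable_swap hs) fun v =>
      (measurable_swap.quasiMeasurePreserving Q).ae_eq (hinv v)
    rw [Filter.eventuallyConst_set] at h ⊢
    refine h.imp ?_ ?_ <;> intro h
    · exact (ae_map_iff measurable_swap.aemeasurable hs).2 h
    · exact (ae_map_iff measurable_swap.aemeasurable hs.compl).2 h

theorem setLIntegral_redDegree_le (W : Set (Space d)) (c : ConfigPair d) :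
    ∫⁻ x in W, redDegree (cimc c.1 c.2) x ∂pointKernel d c.1 ≤ stubCount W c.1 := by
  refine lintegral_mono fun x => ?_
  rw [← ENat.toENNReal_coe]
  exact ENat.toENNReal_le.2 (redDegree_cimc_le c.1 c.2 x)

theorem measurable_setLIntegral_redDegree {W : Set (Space d)} (hW : MeasurableSet W) :
    Measurable fun c : ConfigPair d =>
      ∫⁻ x in W, redDegree (cimc c.1 c.2) x ∂pointKernel d c.1 :=
  measurable_setLIntegral_pointKernel measurable_fst measurable_redDegree_cimc hW

theorem unmatched_subset_compl_of_le {W : Set (Space d)} (hW : MeasurableSet W)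
    {c : ConfigPair d} (hfin : ∫⁻ x in W, redDegree (cimc c.1 c.2) x ∂pointKernel d c.1 ≠ ∞)
    (hle : stubCount W c.1 ≤ ∫⁻ x in W, redDegree (cimc c.1 c.2) x ∂pointKernel d c.1) :
    unmatched c.1 c.2 ⊆ Wᶜ := by
  have hpt : ∀ x, (redDegree (cimc c.1 c.2) x : ℝ≥0∞) ≤ c.1.stubs x := fun x => by
    rw [← ENat.toENNReal_coe]
    exact ENat.toENNReal_le.2 (redDegree_cimc_le c.1 c.2 x)
  have h := ae_eq_of_ae_le_of_lintegral_le (Filter.Eventually.of_forall hpt) hfin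
    (measurable_stubs.comp measurable_prodMk_left).aemeasurable hle
  have h' := ae_pointKernel_iff.1 ((ae_restrict_iff' hW).1 h)
  intro x hx hxW
  exact (redDegree_lt_iff.1 hx).ne (h' x (unmatched_subset _ _ hx) hxW)

theorem ae_unmatched_eq_empty_of_lintegral_le (Q : Measure (ConfigPair d))
    [VAddInvariantMeasure (Space d) (ConfigPair d) Q] {ρ : ℝ} (hρ : 0 < ρ)
    (hfin : ∫⁻ c, stubCount (Metric.ball 0 ρ) c.1 ∂Q ≠ ∞)
    (hle : ∫⁻ c, stubCount (Metric.ball 0 ρ) c.1 ∂Q ≤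
      ∫⁻ c, ∫⁻ x in Metric.ball 0 ρ, redDegree (cimc c.1 c.2) x ∂pointKernel d c.1 ∂Q) :
    ∀ᵐ c ∂Q, unmatched c.1 c.2 = ∅ := by
  refine ae_unmatched_eq_empty_of_ball Q hρ ?_
  have hb : MeasurableSet (Metric.ball (0 : Space d) ρ) := measurableSet_ball
  have hle' := lintegral_mono (μ := Q) fun c => setLIntegral_redDegree_le (Metric.ball 0 ρ) c
  have hmeas : Measurable fun c : ConfigPair d => stubCount (Metric.ball 0 ρ) c.1 :=
    (measurable_stubCount hb).comp measurable_fst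
  have heq := ae_eq_of_ae_le_of_lintegral_le
    (Filter.Eventually.of_forall fun c => setLIntegral_redDegree_le (Metric.ball 0 ρ) c)
    (ne_top_of_le_ne_top hfin hle') hmeas.aemeasurable hle
  filter_upwards [heq, ae_lt_top hmeas hfin] with c hc hct
  exact unmatched_subset_compl_of_le hb (hc ▸ hct.ne) hc.ge

theorem unitVolumeRadius_pos (d : ℕ) : 0 < unitVolumeRadius d :=
  Real.rpow_pos_of_pos (ENNReal.toReal_pos (Metric.measure_ball_pos volume _ one_pos).ne'
    measure_ball_lt_top.ne) _

section Processes

variable {Ω : Type*} [MeasurableSpace Ω] {P : Measure Ω} {R B : Ω → MarkedConfig d}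

/-- The color with the smaller stub intensity is exhausted. If it were not, then by ergodicity it
would almost surely have unmatched points, so the other color would be exhausted and by mass
transport the smaller stub intensity would be used up entirely. -/
theorem ae_unmatched_eq_empty [IsProbabilityMeasure P] (hd : 1 ≤ d)
    (hR : Measurable R) (hB : Measurable B)
    (hergodic : ErgodicVAdd (Space d) (ConfigPair d) (P.map fun ω => (R ω, B ω)))
    {ν μ : Measure ℕ} [IsProbabilityMeasure ν] [IsProbabilityMeasure μ]
    (hRmarks : HasIIDMarks P R ν) (hBmarks : HasIIDMarks P B μ)
    (hfin : intensity P R * mean ν < ∞)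
    (hdist : ∀ᵐ ω ∂P, NonEquidistant ((R ω).points ∪ (B ω).points))
    (hchain : ∀ᵐ ω ∂P, ¬ ∃ x : ℕ → Space d,
      IsDescendingChain ((R ω).points ∪ (B ω).points) x)
    (hle : intensity P R * mean ν ≤ intensity P B * mean μ) :
    ∀ᵐ ω ∂P, unmatched (R ω) (B ω) = ∅ := by
  have hRB : Measurable fun ω => (R ω, B ω) := hR.prodMk hB
  have : IsProbabilityMeasure (P.map fun ω => (R ω, B ω)) :=
    Measure.isProbabilityMeasure_map hRB.aemeasurable
  set Q := P.map fun ω => (R ω, B ω) with hQ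
  set W := Metric.ball (0 : Space d) (unitVolumeRadius d) with hW
  have hWm : MeasurableSet W := measurableSet_ball
  have hred : ∫⁻ c, stubCount W c.1 ∂Q = intensity P R * mean ν := by
    have hmeas : Measurable fun c : ConfigPair d => stubCount W c.1 :=
      (measurable_stubCount hWm).comp measurable_fst
    rw [hQ, lintegral_map hmeas hRB,
      hRmarks.lintegral_stubCount hR hWm Metric.isBounded_ball]
    rfl
  rcases ae_unmatched_const Q with hne | hempty
  · refine ae_of_ae_map hRB.aemeasurable
      (ae_unmatched_eq_empty_of_lintegral_le Q (unitVolumeRadius_pos d) (hred ▸ hfin.ne) ?_)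
    have hblue : ∀ᵐ ω ∂P, unmatched (B ω) (R ω) = ∅ := by
      filter_upwards [ae_of_ae_map hRB.aemeasurable hne,
        ae_of_ae_map hRB.aemeasurable (ae_unmatched_empty_or_infinite hd Q), hdist, hchain]
        with ω h1 h2 h3 h4
      by_contra hcon
      exact h2.elim h1.ne_empty fun h => h (finite_unmatched h3 h4 (nonempty_iff_ne_empty.2 hcon))
    have hmeas : Measurable fun c : ConfigPair d =>
        ∫⁻ y in W, redDegree (cimc c.2 c.1) y ∂pointKernel d c.2 :=
      (measurable_setLIntegral_redDegree hWm).comp measurable_swap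
    rw [hred, lintegral_redDegree_eq_lintegral_blueDegree Q hWm
      (volume_ball_unitVolumeRadius hd), hQ, lintegral_map hmeas hRB]
    refine hle.trans (le_of_eq ?_)
    trans ∫⁻ ω, stubCount W (B ω) ∂P
    · exact (hBmarks.lintegral_stubCount hB hWm Metric.isBounded_ball).symm
    · refine lintegral_congr_ae ?_
      filter_upwards [hblue] with ω hω
      refine lintegral_congr fun y => ?_
      have hy : y ∉ unmatched (B ω) (R ω) := hω ▸ notMem_empty y
      rw [le_antisymm (redDegree_cimc_le (B ω) (R ω) y) (not_lt.1 hy), ENat.toENNReal_coe]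
  · exact ae_of_ae_map hRB.aemeasurable hempty

theorem isInvariantEdgeProcess_cimc (hR : Measurable R) (hB : Measurable B)
    (hinv : VAddInvariantMeasure (Space d) (ConfigPair d) (P.map fun ω => (R ω, B ω))) :
    IsInvariantEdgeProcess P fun ω => cimc (R ω) (B ω) where
  measurable := measurable_edgeMeasure_cimc.comp (hR.prodMk hB)
  invariant v := by
    have hRB : Measurable fun ω => (R ω, B ω) := hR.prodMk hB
    have hv := measurePreserving_vadd_pair v (P.map fun ω => (R ω, B ω))
    simp_rw [← cimc_vadd]
    have h1 : P.map (fun ω => edgeMeasure (cimc (R ω) (B ω))) =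
        (P.map fun ω => (R ω, B ω)).map fun c => edgeMeasure (cimc c.1 c.2) :=
      (Measure.map_map measurable_edgeMeasure_cimc hRB).symm
    rw [h1]
    conv_rhs => rw [← hv.map_eq]
    rw [Measure.map_map measurable_edgeMeasure_cimc hv.measurable,
      Measure.map_map (measurable_edgeMeasure_cimc.comp hv.measurable) hRB]
    rfl

theorem isPartialStableScheme_cimc (hR : Measurable R) (hB : Measurable B)
    (hinv : VAddInvariantMeasure (Space d) (ConfigPair d) (P.map fun ω => (R ω, B ω)))
    (hdist : ∀ᵐ ω ∂P, NonEquidistant ((R ω).points ∪ (B ω).points))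
    (hchain : ∀ᵐ ω ∂P, ¬ ∃ x : ℕ → Space d,
      IsDescendingChain ((R ω).points ∪ (B ω).points) x) :
    IsPartialStableScheme P R B fun ω => cimc (R ω) (B ω) where
  process := isInvariantEdgeProcess_cimc hR hB hinv
  matching := Filter.Eventually.of_forall fun ω => isPartialMultiMatching_cimc (R ω) (B ω)
  stable := by
    filter_upwards [hdist, hchain] with ω h1 h2
    exact isPartialStable_cimc h1 h2

end Processes

end TwoColor

theorem proposition2p1 {d : ℕ} (hd : 1 ≤ d)
    {Ω : Type*} [MeasurableSpace Ω] (P : Measure Ω) [IsProbabilityMeasure P]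
    (R B : Ω → TwoColor.MarkedConfig d) (hR : Measurable R) (hB : Measurable B)
    -- the joint law of the two marked processes is translation-invariant and ergodic
    (hergodic : ErgodicVAdd (TwoColor.Space d)
      (TwoColor.MarkedConfig d × TwoColor.MarkedConfig d) (P.map fun ω => (R ω, B ω)))
    (hRint : TwoColor.intensity P R < ∞) (hBint : TwoColor.intensity P B < ∞)
    (ν μ : Measure ℕ) [IsProbabilityMeasure ν] [IsProbabilityMeasure μ]
    (hν : ν {0} = 0) (hμ : μ {0} = 0)
    (hRmarks : TwoColor.HasIIDMarks P R ν) (hBmarks : TwoColor.HasIIDMarks P B μ)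
    (hνmean : TwoColor.mean ν < ∞) (hμmean : TwoColor.mean μ < ∞)
    (hdist : ∀ᵐ ω ∂P, TwoColor.NonEquidistant ((R ω).points ∪ (B ω).points))
    (hchain : ∀ᵐ ω ∂P, ¬ ∃ x : ℕ → TwoColor.Space d,
      TwoColor.IsDescendingChain ((R ω).points ∪ (B ω).points) x) :
    -- (a)
    (TwoColor.intensity P R * TwoColor.mean ν = TwoColor.intensity P B * TwoColor.mean μ →
      TwoColor.IsStableScheme P R B (fun ω => TwoColor.cimc (R ω) (B ω)) ∧
      ∀ᵐ ω ∂P, ∀ M : TwoColor.EdgeSet d, TwoColor.IsMultiMatching (R ω) (B ω) M →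
        TwoColor.IsStable (R ω) (B ω) M → M = TwoColor.cimc (R ω) (B ω)) ∧
    -- (b)
    (TwoColor.intensity P R * TwoColor.mean ν < TwoColor.intensity P B * TwoColor.mean μ →
      TwoColor.IsPartialStableScheme P R B (fun ω => TwoColor.cimc (R ω) (B ω)) ∧
      ∀ᵐ ω ∂P, TwoColor.ExhaustsRed (R ω) (TwoColor.cimc (R ω) (B ω))) ∧
    (TwoColor.intensity P B * TwoColor.mean μ < TwoColor.intensity P R * TwoColor.mean ν →
      TwoColor.IsPartialStableScheme P R B (fun ω => TwoColor.cimc (R ω) (B ω)) ∧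
      ∀ᵐ ω ∂P, TwoColor.ExhaustsBlue (B ω) (TwoColor.cimc (R ω) (B ω))) := by
  have hscheme := TwoColor.isPartialStableScheme_cimc hR hB hergodic.toVAddInvariantMeasure
    hdist hchain
  have hred : TwoColor.intensity P R * TwoColor.mean ν ≤
      TwoColor.intensity P B * TwoColor.mean μ →
      ∀ᵐ ω ∂P, TwoColor.ExhaustsRed (R ω) (TwoColor.cimc (R ω) (B ω)) := fun hle =>
    (TwoColor.ae_unmatched_eq_empty hd hR hB hergodic hRmarks hBmarks
      (ENNReal.mul_lt_top hRint hνmean) hdist hchain hle).mono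
      fun ω => TwoColor.exhaustsRed_cimc
  have hswap : ErgodicVAdd (TwoColor.Space d) (TwoColor.ConfigPair d)
      (P.map fun ω => (B ω, R ω)) := by
    have h := TwoColor.ergodicVAdd_map_swap hergodic
    rwa [Measure.map_map measurable_swap (hR.prodMk hB)] at h
  have hblue : TwoColor.intensity P B * TwoColor.mean μ ≤
      TwoColor.intensity P R * TwoColor.mean ν →
      ∀ᵐ ω ∂P, TwoColor.ExhaustsBlue (B ω) (TwoColor.cimc (R ω) (B ω)) := fun hle =>
    (TwoColor.ae_unmatched_eq_empty hd hB hR hswap hBmarks hRmarks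
      (ENNReal.mul_lt_top hBint hμmean) (by simpa only [union_comm] using hdist)
      (by simpa only [union_comm] using hchain) hle).mono
      fun ω => TwoColor.exhaustsBlue_cimc
  refine ⟨fun h => ⟨⟨hscheme.process, ?_, ?_⟩, ?_⟩, fun h => ⟨hscheme, hred h.le⟩,
    fun h => ⟨hscheme, hblue h.le⟩⟩
  · filter_upwards [hred h.le, hblue h.ge] with ω h1 h2
    exact ⟨TwoColor.cimc_subset _ _, h1, h2⟩
  · filter_upwards [hscheme.stable] with ω hω using hω.isStable
  · filter_upwards [hred h.le] with ω hω M hM hs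
    exact hM.eq_cimc hs hω
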